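/- **Model.** Fix $K\in\mathbb N$. For each $N$ there are $N$ stations, each of capacity $K$, and $M=M^N$ bikes. Customers arrive at station $i$ as a Poisson process of rate $\lambda_i^N>0$ and take a bike if there is one; every bike in circulation arrives, after an exponential time of mean $1$, at a uniformly chosen station and is returned there if that station is not full, and otherwise rides on in the same way. Thus $X^N(t)=(X_1^N(t),\dots,X_N^N(t))$, the numbers of bikes at the stations, is a continuous-time Markov chain with RCLL paths on $\{0,\dots,K\}^N$, with $\sum_i X^N_i(0)\le M$ almost surely, which jumps from $x$ to $x-e_i$ at rate $\lambda_i^N\mathbf 1_{x_i>0}$ and to $x+e_i$ at rate $\frac1N\bigl(M-\sum_j x_j\bigr)\mathbf 1_{x_i<K}$. Let $R_i^N=\frac{1}{N\lambda_i^N}$, $R^N_{\max}=\max_iR_i^N$, $r_i^N=R_i^N/R^N_{\max}\in\,]0,1]$, and $$Y^N_t(\cdot,k)=\frac1N\sum_{i=1}^N\mathbf 1_{\{X_i^N(t)=k\}}\,\delta_{r_i^N},\qquad Y^N_t(k)=\frac1N\#\{i:X_i^N(t)=k\},\qquad k=0,\dots,K.$$ **Theorem.** Assume that $\sup_{N,i}\lambda_i^N<\infty$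 and that there are $\Lambda>0$, $\gamma\in\mathbb R$ and a probability measure $I$ such that, as $N\to\infty$, $\frac1N\sum_{i=1}^N\delta_{r_i^N}\Rightarrow I$, $N R^N_{\max}\to\Lambda^{-1}$ and $M/N\to\gamma$. Suppose that for some finite measures $y_0(dr,k)$, $k=0,\dots,K$, $Y_0^N\to y_0$ weakly in probability, that is, $\int f(r)\,Y_0^N(dr,k)\to\int f(r)\,y_0(dr,k)$ in probability for every bounded continuous $f$ and every $k$. Then there is a unique family $y_t(dr,k)$, $t\ge0$, of finite measures on $]0,1]\times\{0,\dots,K\}$ with $\int r^{-1}\,y_t(dr,k)<\infty$ for all $t,k$, that starts at $y_0$ and solves $\dot y_t=b(y_t)$, in the sense that $\frac{d}{dt}y_t(B,k)=b(y_t)(B,k)$ for all $t\ge0$, $k$ and Borel sets $B$, where $$b(y)(B,k)=\mathbf 1_{k<K}\int_B\frac{\Lambda}{r}\,y(dr,k+1)-\mathbf 1_{k>0}\int_B\frac{\Lambda}{r}\,y(dr,k)+\Bigl(\gamma-\sum_{n=0}^K n\,y(n)\Bigr)\bigl(\mathbf 1_{k>0}\,y(B,k-1)-\mathbf 1_{k<K}\,y(B,k)\bigr)$$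 and $y(n)=\int y(dr,n)$. Moreover, with the vectors $Y_t^N=(Y_t^N(0),\dots,Y_t^N(K))$ and $y_t=(y_t(0),\dots,y_t(K))$ and the Euclidean norm $|\cdot|$ of $\mathbb R^{K+1}$, for all $\epsilon>0$ and $t_0>0$, $$\lim_{N\to\infty}P\Bigl(\sup_{t\le t_0}\bigl|Y_t^N-y_t\bigr|>\epsilon\Bigr)=0 .$$ -/

import Mathlib

open MeasureTheory ProbabilityTheory Filter Topology Set
open scoped NNReal ENNReal BoundedContinuousFunction

noncomputable section

namespace BikeSharing

/-! ### Continuous-time Markov chains on a finite state space -/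

/-- The generator matrix with off-diagonal entries `q x y` and zero row sums. -/
def generator {S : Type*} [Fintype S] [DecidableEq S] (q : S → S → ℝ) : Matrix S S ℝ :=
  Matrix.of fun x y => if x = y then -∑ z ∈ Finset.univ.erase x, q x z else q x y

/-- `X` is a continuous-time Markov chain with generator `Q` on the finite set `S` (with an
arbitrary initial law): its paths are right-continuous with left limits for the discrete topology
of `S`, and for some filtration to which it is adapted, its transition probabilities are
`P(X t = y | ℱ s) = exp ((t - s) Q) (X s, y)`. -/
structure IsCTMC {Ω : Type*} {mΩ : MeasurableSpace Ω} (P : Measure Ω)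
    {S : Type*} [Fintype S] [DecidableEq S] [MeasurableSpace S]
    (Q : Matrix S S ℝ) (X : ℝ≥0 → Ω → S) : Prop where
  right_continuous : ∀ ω t, ∀ᶠ s in 𝓝[>] t, X s ω = X t ω
  left_limits : ∀ ω t, ∃ x, ∀ᶠ s in 𝓝[<] t, X s ω = x
  markov : ∃ ℱ : Filtration ℝ≥0 mΩ, (∀ t, Measurable[ℱ t] (X t)) ∧
    ∀ s t : ℝ≥0, s ≤ t → ∀ y : S,
      P[(X t ⁻¹' {y}).indicator (fun _ => (1 : ℝ)) | ℱ s] =ᵐ[P]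
        fun ω => NormedSpace.exp (((t : ℝ) - (s : ℝ)) • Q) (X s ω) y

/-! ### The bike-sharing model -/

/-- The state of `N` stations of capacity `K`: `x i` is the number of bikes at station `i`. -/
abbrev State (K N : ℕ) : Type := Fin N → Fin (K + 1)

/-- Jump rates with `N` stations, `M` bikes, arrival rate `lam i` at station `i`, mean travel
time `1` and uniform routing probabilities `1 / N`. A bike is taken from station `i` at rate
`lam i` (possible only if the station is not empty), and one of the `M - ∑ j, x j` bikes in
circulation is returned to station `i` at rate `(1 / N) (M - ∑ j, x j)` (possible only if the
station is not full). Only states with `∑ j, x j ≤ M` occur, so the subtraction is genuine. -/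
def jumpRate {K N : ℕ} (M : ℕ) (lam : Fin N → ℝ) (x y : State K N) : ℝ :=
  ∑ i, ((if (y i : ℕ) + 1 = x i ∧ ∀ j, j ≠ i → y j = x j then lam i else 0) +
    (if (y i : ℕ) = x i + 1 ∧ ∀ j, j ≠ i → y j = x j then
      (1 / (N : ℝ)) * ((M - ∑ j, (x j : ℕ) : ℕ) : ℝ) else 0))

/-- The utilization `R i = μ P_i / λ_i` of station `i`, with `μ = 1` and `P_i = 1 / N`. -/
def utilization {N : ℕ} (lam : Fin N → ℝ) (i : Fin N) : ℝ := (1 / (N : ℝ)) / lam i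

/-- The maximal utilization. -/
def maxUtilization {N : ℕ} (lam : Fin N → ℝ) : ℝ := ⨆ i, utilization lam i

/-- The relative utilization `r i = R i / R_max`. -/
def relUtilization {N : ℕ} (lam : Fin N → ℝ) (i : Fin N) : ℝ :=
  utilization lam i / maxUtilization lam

/-- The empirical law of the points `r 1, …, r N`. -/
def empiricalLaw {N : ℕ} (r : Fin N → ℝ) : Measure ℝ :=
  (N : ℝ≥0∞)⁻¹ • ∑ i, Measure.dirac (r i)

/-- The empirical measure of (relative utilization, number of bikes), restricted to the stations
with `k` bikes: its value at `{ρ}` is the proportion of stations `i` with `r i = ρ`, `x i = k`. -/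
def empiricalMeasure {K N : ℕ} (r : Fin N → ℝ) (x : State K N) (k : Fin (K + 1)) : Measure ℝ :=
  (N : ℝ≥0∞)⁻¹ • ∑ i, if x i = k then Measure.dirac (r i) else 0

/-- The proportions of stations with `0, …, K` bikes, as a vector of Euclidean `(K+1)`-space. -/
def proportions {K N : ℕ} (x : State K N) : EuclideanSpace ℝ (Fin (K + 1)) :=
  WithLp.toLp 2 fun k => (1 / (N : ℝ)) * ∑ i, if x i = k then 1 else 0

/-! ### The mean-field equation

A measure `y(dr, k)` on `]0,1] × {0, …, K}` is given by its slices `y k`, `k = 0, …, K`. -/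

/-- The vector `(y(0), …, y(K))` of total masses `y(k) = ∫ y(dr, k)`. -/
def masses {K : ℕ} (y : Fin (K + 1) → Measure ℝ) : EuclideanSpace ℝ (Fin (K + 1)) :=
  WithLp.toLp 2 fun k => (y k).real univ

/-- The average number of bikes per station, `∑ n, ∫ n y(dr, n)`. -/
def meanBikes {K : ℕ} (y : Fin (K + 1) → Measure ℝ) : ℝ :=
  ∑ n : Fin (K + 1), (n : ℝ) * (y n).real univ

/-- The mean-field drift `b(y)`, a signed measure on `]0,1] × {0, …, K}`, evaluated at `B × {k}`:
`∑ n ∫_B [ (Λ / r) (1_{n-1} - 1_n) 1_{n > 0} + (γ - ∑ m m y(m)) (1_{n+1} - 1_n) 1_{n < K} ](k)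
y(dr, n)`. -/
def drift {K : ℕ} (Λ γ : ℝ) (y : Fin (K + 1) → Measure ℝ) (B : Set ℝ) (k : Fin (K + 1)) : ℝ :=
  ∑ n : Fin (K + 1),
    ((if 0 < (n : ℕ) then
        (∫ r in B, Λ / r ∂(y n)) *
          ((if (k : ℕ) + 1 = n then 1 else 0) - (if k = n then 1 else 0))
      else 0) +
     (if (n : ℕ) < K then
        (γ - meanBikes y) * (y n).real B *
          ((if (k : ℕ) = n + 1 then 1 else 0) - (if k = n then 1 else 0))
      else 0))

/-- `y` solves `dy_t / dt = b(y_t)`, `t ≥ 0`, with initial value `y₀`, in the space of finite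
measures on `]0,1] × {0, …, K}`; the derivative is taken setwise (with `B` the whole line this is
the equation for the masses `y_t(k)`). -/
structure IsMeanFieldSolution {K : ℕ} (Λ γ : ℝ) (y₀ : Fin (K + 1) → Measure ℝ)
    (y : ℝ → Fin (K + 1) → Measure ℝ) : Prop where
  initial : y 0 = y₀
  finite : ∀ t, 0 ≤ t → ∀ k, IsFiniteMeasure (y t k)
  support : ∀ t, 0 ≤ t → ∀ k, y t k (Ioc 0 1)ᶜ = 0
  integrable : ∀ t, 0 ≤ t → ∀ k, Integrable (fun r : ℝ => Λ / r) (y t k)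
  hasDeriv : ∀ t, 0 ≤ t → ∀ k, ∀ B : Set ℝ, MeasurableSet B →
    HasDerivWithinAt (fun s => (y s k).real B) (drift Λ γ (y t) B k) (Ici 0) t

end BikeSharing

end

noncomputable section

namespace BikeSharing

/-! ### A maximal inequality for sums of martingale differences -/

/-! The difficulty is that the masses `y(k)` do not satisfy a closed equation: bikes leave station
`i` at a rate depending on `r i`. Bounded arrival rates remove the singularity of `Λ / r`: for some
`c > 0` and all large `N`, every relative utilization lies in `[c, 1]`, and with `w(r) = c / max r
c` one has `lam i = s N * w(r i)`, where `s N → C` and `Λ = C * c` (`exists_rate_bound`). The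
generator sends the moment `∫ w ^ a Y(dr, k)` to moments of order `a + 1` and to moments of order
`a` times the return rate, itself a function of the moments of order `0` (`sum_jumpRate_moment`).
The limit satisfies the same infinite hierarchy with `C` and `γ` in place of `s N` and `M / N`.

All moments lie in `[0, 1]`. Weighting level `a` by `2 ^ (-a)` and cutting at level `m` therefore
closes the hierarchy up to an error of order `2 ^ (-m)`, and Grönwall's inequality applies
(`hierarchy_gronwall`, `momentDist_grid_le`). The noise is small because a jump changes a moment by
at most `1 / N`: the carré du champ is `O(1 / N)` (`sum_jumpRate_moment_sq_le`), and a maximal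
inequality for the chain sampled on a grid controls the martingale part
(`IsCTMC.eventually_measure_le`). Right continuity passes from dyadic grids to all times
(`measure_lt_iSup_le`), and `tendsto_measure_lt_iSup` combines these.

Existence: look for `y_t` as `y₀` transported by densities `p_t(j, k, r)`, the probabilities of
going from `j` to `k` bikes at a station of utilization `r`. They solve an ordinary differential
equation in a Banach space of bounded continuous functions (`exists_transition_solution`).
Uniqueness: the equation conserves `∑ k, y_t(B, k)` for each `B`, so every solution stays on `[c,
1]`, where the drift is Lipschitz uniformly over sets, and Picard iteration gives
`IsMeanFieldSolution.eq`. -/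

theorem setIntegral_mul_eq_zero_of_condExp_eq_zero {Ω : Type*} {m m0 : MeasurableSpace Ω}
    {μ : Measure Ω} [IsProbabilityMeasure μ] (hm : m ≤ m0) {S d : Ω → ℝ}
    (hS : StronglyMeasurable[m] S) (hSd : Integrable (S * d) μ) (hd : Integrable d μ)
    (h0 : μ[d | m] =ᵐ[μ] 0) {A : Set Ω} (hA : MeasurableSet[m] A) :
    ∫ ω in A, S ω * d ω ∂μ = 0 := by
  have h1 : μ[S * d | m] =ᵐ[μ] 0 := by
    filter_upwards [condExp_mul_of_stronglyMeasurable_left hS hSd hd, h0] with ω h2 h3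
    rw [h2]; simp [h3]
  have h4 := setIntegral_condExp hm hSd hA
  have h5 : ∫ ω in A, (μ[S * d | m]) ω ∂μ = 0 := by
    rw [setIntegral_congr_ae (g := fun _ => (0 : ℝ)) (hm _ hA)
      (by filter_upwards [h1] with ω h _ using h)]
    simp
  rw [h5] at h4
  exact h4.symm

/-- Kolmogorov's maximal inequality for the partial sums of bounded martingale differences. -/
theorem measure_exists_le_abs_sum_le {Ω : Type*} {m0 : MeasurableSpace Ω} {μ : Measure Ω}
    [IsProbabilityMeasure μ] {𝒢 : Filtration ℕ m0} {d : ℕ → Ω → ℝ}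
    (hd : ∀ i, StronglyMeasurable[𝒢 (i + 1)] (d i)) {C : ℝ} (hC : ∀ i ω, |d i ω| ≤ C)
    (h0 : ∀ i, μ[d i | 𝒢 i] =ᵐ[μ] 0) {V : ℝ} (hV : ∀ i, ∫ ω, d i ω ^ 2 ∂μ ≤ V)
    (n : ℕ) {δ : ℝ} (hδ : 0 < δ) :
    μ {ω | ∃ j ≤ n, δ ≤ |∑ i ∈ Finset.range j, d i ω|} ≤ ENNReal.ofReal (n * V / δ ^ 2) := by
  set S : ℕ → Ω → ℝ := fun j ω => ∑ i ∈ Finset.range j, d i ω with hS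
  have hSm : ∀ j, StronglyMeasurable[𝒢 j] (S j) := fun j =>
    Finset.stronglyMeasurable_fun_sum _ fun i hi =>
      (hd i).mono (𝒢.mono (Nat.succ_le_of_lt (Finset.mem_range.1 hi)))
  have hSb : ∀ j ω, |S j ω| ≤ j * C := fun j ω => by
    refine (Finset.abs_sum_le_sum_abs _ _).trans ((Finset.sum_le_sum fun i _ => hC i ω).trans ?_)
    simp
  have hdi : ∀ i, Integrable (d i) μ := fun i =>
    Integrable.of_bound ((hd i).mono (𝒢.le _)).aestronglyMeasurable C (ae_of_all _ fun ω => hC i ω)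
  have hSdi : ∀ i, Integrable (S i * d i) μ := fun i =>
    Integrable.of_bound (((hSm i).mono (𝒢.le _)).mul ((hd i).mono (𝒢.le _))).aestronglyMeasurable
      (i * C * C) (ae_of_all _ fun ω => by
        simp only [Pi.mul_apply, norm_mul, Real.norm_eq_abs]
        exact mul_le_mul (hSb i ω) (hC i ω) (abs_nonneg _) ((abs_nonneg _).trans (hSb i ω)))
  have hd2 : ∀ i, Integrable (fun ω => d i ω ^ 2) μ := fun i =>
    Integrable.of_bound (((hd i).mono (𝒢.le _)).pow 2).aestronglyMeasurable
      (C ^ 2) (ae_of_all _ fun ω => by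
        rw [norm_pow]
        exact pow_le_pow_left₀ (norm_nonneg _) (hC i ω) 2)
  have hS2 : ∀ i, Integrable (fun ω => S i ω ^ 2) μ := fun i =>
    Integrable.of_bound (((hSm i).mono (𝒢.le _)).pow 2).aestronglyMeasurable
      ((i * C) ^ 2) (ae_of_all _ fun ω => by
        rw [norm_pow]
        exact pow_le_pow_left₀ (norm_nonneg _) (hSb i ω) 2)
  -- The increment is orthogonal to the past. Arbitrary `A` gives the submartingale property of `S ^
  -- 2`; `A = univ` gives the variance bound.
  have hstep : ∀ i, ∀ A, MeasurableSet[𝒢 i] A →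
      ∫ ω in A, S (i + 1) ω ^ 2 ∂μ = ∫ ω in A, S i ω ^ 2 ∂μ + ∫ ω in A, d i ω ^ 2 ∂μ := by
    intro i A hA
    have hz := setIntegral_mul_eq_zero_of_condExp_eq_zero (𝒢.le i) (hSm i) (hSdi i) (hdi i) (h0 i) hA
    have hexp : ∀ ω, S (i + 1) ω ^ 2 = S i ω ^ 2 + d i ω ^ 2 + 2 * (S i ω * d i ω) := fun ω => by
      simp only [hS, Finset.sum_range_succ]; ring
    simp only [hexp]
    have h1 : Integrable (fun ω => S i ω ^ 2 + d i ω ^ 2) (μ.restrict A) :=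
      ((hS2 i).add (hd2 i)).integrableOn
    have h2 : Integrable (fun ω => 2 * (S i ω * d i ω)) (μ.restrict A) :=
      ((hSdi i).const_mul 2).integrableOn
    rw [integral_add h1 h2,
      integral_add (hS2 i).integrableOn (hd2 i).integrableOn, integral_const_mul, hz]
    ring
  have hsub : Submartingale (fun j ω => S j ω ^ 2) 𝒢 μ :=
    submartingale_of_setIntegral_le_succ (fun j => (hSm j).pow 2) hS2 fun i A hA => by
      rw [hstep i A hA]
      exact le_add_of_nonneg_right (integral_nonneg fun ω => sq_nonneg _)
  have hVn : ∀ j : ℕ, ∫ ω, S j ω ^ 2 ∂μ ≤ j * V := by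
    intro j
    induction j with
    | zero => simp [hS]
    | succ j ih =>
      have := hstep j univ MeasurableSet.univ
      simp only [setIntegral_univ] at this
      rw [this]; push_cast
      linarith [hV j]
  have hmax := maximal_ineq hsub (fun _ _ => sq_nonneg _) (ε := Real.toNNReal (δ ^ 2)) n
  have hδ2 : 0 < δ ^ 2 := by positivity
  rw [Real.coe_toNNReal _ hδ2.le] at hmax
  set E := {ω | δ ^ 2 ≤ (Finset.range (n + 1)).sup' Finset.nonempty_range_add_one
    fun k => S k ω ^ 2}
  have hsubset : {ω | ∃ j ≤ n, δ ≤ |S j ω|} ⊆ E := by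
    rintro ω ⟨j, hj, h⟩
    have h1 : δ ^ 2 ≤ S j ω ^ 2 := by
      rw [← sq_abs (S j ω)]
      exact pow_le_pow_left₀ hδ.le h 2
    exact h1.trans (Finset.le_sup' (fun k => S k ω ^ 2)
      (Finset.mem_range.2 (Nat.lt_succ_of_le hj)))
  refine (measure_mono hsubset).trans ?_
  have h2 : ENNReal.ofReal (δ ^ 2) * μ E ≤ ENNReal.ofReal (n * V) :=
    hmax.trans (ENNReal.ofReal_le_ofReal
      ((setIntegral_le_integral (hS2 n) (ae_of_all _ fun ω => sq_nonneg _)).trans (hVn n)))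
  rw [ENNReal.ofReal_div_of_pos hδ2, ENNReal.le_div_iff_mul_le]
  · rwa [mul_comm]
  · exact Or.inl (by simpa using hδ.ne')
  · exact Or.inl ENNReal.ofReal_ne_top

/-! ### Continuous-time Markov chains on a grid -/

/-- The derivative of `exp (t Q)` at `0` is `Q`; finiteness of `S` makes the expansion uniform in
the entries. The operator norm is needed only to differentiate the exponential. -/
theorem exp_smul_entry_sub_le {S : Type*} [Fintype S] [DecidableEq S] (Q : Matrix S S ℝ) {η : ℝ} (hη : 0 < η) :
    ∀ᶠ h : ℝ in 𝓝[>] 0, ∀ x y,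
      |NormedSpace.exp (h • Q) x y - ((1 : Matrix S S ℝ) x y + h * Q x y)| ≤ η * h := by
  have hder : HasDerivAt (fun t : ℝ => NormedSpace.exp (t • Q)) Q 0 := by
    let _ : NormedRing (Matrix S S ℝ) := Matrix.linftyOpNormedRing
    let _ : NormedAlgebra ℝ (Matrix S S ℝ) := Matrix.linftyOpNormedAlgebra
    have := hasDerivAt_exp_smul_const (𝕂 := ℝ) Q (0 : ℝ)
    rw [zero_smul, NormedSpace.exp_zero, one_mul] at this
    exact this
  have hent : ∀ x y, HasDerivAt (fun t : ℝ => NormedSpace.exp (t • Q) x y) (Q x y) 0 := by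
    intro x y
    have h1 := hasDerivAt_pi.1 hder x
    exact hasDerivAt_pi.1 h1 y
  rw [eventually_all]
  intro x
  rw [eventually_all]
  intro y
  have h2 := (hasDerivAt_iff_isLittleO.1 (hent x y)).def hη
  have h3 := h2.filter_mono (nhdsWithin_le_nhds (s := Ioi 0))
  filter_upwards [h3, self_mem_nhdsWithin] with h h4 h5
  simp only [zero_smul, NormedSpace.exp_zero, sub_zero, smul_eq_mul, Real.norm_eq_abs] at h4
  rw [abs_of_pos (show (0 : ℝ) < h from h5)] at h4
  rwa [sub_add_eq_sub_sub]

/-- Row sums vanish, so `f x` may be subtracted; the value `q x x` is then irrelevant. -/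
theorem generator_mulVec {S : Type*} [Fintype S] [DecidableEq S] (q : S → S → ℝ) (f : S → ℝ) (x : S) :
    ∑ y, generator q x y * f y = ∑ y, q x y * (f y - f x) := by
  rw [← Finset.add_sum_erase _ _ (Finset.mem_univ x),
    ← Finset.add_sum_erase _ (fun y => q x y * (f y - f x)) (Finset.mem_univ x)]
  simp only [generator, Matrix.of_apply, if_true, sub_self, mul_zero, zero_add]
  have : ∀ y ∈ Finset.univ.erase x, (if x = y then -∑ z ∈ Finset.univ.erase x, q x z
      else q x y) * f y = q x y * f y := fun y hy => by
    rw [if_neg (Finset.ne_of_mem_erase hy).symm]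
  rw [Finset.sum_congr rfl this]
  simp only [mul_sub, Finset.sum_sub_distrib, ← Finset.sum_mul]
  ring

theorem sum_mul_indicator_preimage {Ω S : Type*} [Fintype S] (Y : Ω → S) (g : S → ℝ) (ω : Ω) :
    ∑ y, g y * (Y ⁻¹' {y}).indicator (fun _ => (1 : ℝ)) ω = g (Y ω) := by
  rw [Finset.sum_eq_single (Y ω)]
  · simp
  · intro y _ hy
    simp [indicator, hy.symm]
  · simp

theorem integrable_comp_finite {Ω S : Type*} {mΩ : MeasurableSpace Ω} {P : Measure Ω}
    [IsProbabilityMeasure P] [Fintype S] [MeasurableSpace S] [MeasurableSingletonClass S]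
    {Y : Ω → S} (hY : Measurable Y) (g : S → ℝ) :
    Integrable (fun ω => g (Y ω)) P :=
  Integrable.of_bound ((measurable_of_finite g).comp hY).aestronglyMeasurable (∑ y, |g y|)
    (ae_of_all _ fun ω => Finset.single_le_sum (f := fun y => |g y|) (fun _ _ => abs_nonneg _)
      (Finset.mem_univ (Y ω)))

section Chain

variable {Ω : Type*} {mΩ : MeasurableSpace Ω} {P : Measure Ω} [IsProbabilityMeasure P]
  {S : Type*} [Fintype S] [DecidableEq S] [MeasurableSpace S] [MeasurableSingletonClass S]
  {Q : Matrix S S ℝ} {X : ℝ≥0 → Ω → S} {ℱ : Filtration ℝ≥0 mΩ}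

/-- The information available at the times `0, h, 2h, …`. -/
def gridFiltration (ℱ : Filtration ℝ≥0 mΩ) (h : ℝ≥0) : Filtration ℕ mΩ where
  seq j := ℱ (j * h)
  mono' i j hij := ℱ.mono (by gcongr)
  le' j := ℱ.le _

/-- Expand `φ (X s) (X t)` over the values of `X t`; each coefficient `φ (X s) y` is known at time
`s` and comes out of the conditional expectation. -/
theorem integral_comp_pair (hX : ∀ t, Measurable[ℱ t] (X t))
    (hmark : ∀ s t : ℝ≥0, s ≤ t → ∀ y : S,
      P[(X t ⁻¹' {y}).indicator (fun _ => (1 : ℝ)) | ℱ s] =ᵐ[P]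
        fun ω => NormedSpace.exp (((t : ℝ) - (s : ℝ)) • Q) (X s ω) y)
    {s t : ℝ≥0} (hst : s ≤ t) (φ : S → S → ℝ) :
    ∫ ω, φ (X s ω) (X t ω) ∂P =
      ∫ ω, ∑ y, NormedSpace.exp (((t : ℝ) - (s : ℝ)) • Q) (X s ω) y * φ (X s ω) y ∂P := by
  have hXm : ∀ t, Measurable (X t) := fun t => (hX t).mono (ℱ.le t) le_rfl
  have hone : ∀ y, Integrable ((X t ⁻¹' {y}).indicator fun _ => (1 : ℝ)) P := fun y =>
    (integrable_const 1).indicator (hXm t (measurableSet_singleton y))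
  have hg : ∀ y, StronglyMeasurable[ℱ s] fun ω => φ (X s ω) y := fun y =>
    ((measurable_of_finite fun x => φ x y).comp (hX s)).stronglyMeasurable
  have hmul : ∀ y, Integrable
      ((fun ω => φ (X s ω) y) * (X t ⁻¹' {y}).indicator fun _ => (1 : ℝ)) P := fun y =>
    (hone y).bdd_mul (c := ∑ x, |φ x y|) ((hg y).mono (ℱ.le s)).aestronglyMeasurable
      (ae_of_all _ fun ω => Finset.single_le_sum (f := fun x => |φ x y|)
        (fun x _ => abs_nonneg _) (Finset.mem_univ (X s ω)))
  have h1 : ∀ ω, φ (X s ω) (X t ω) =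
      ∑ y, ((fun ω => φ (X s ω) y) * (X t ⁻¹' {y}).indicator fun _ => (1 : ℝ)) ω := fun ω =>
    (sum_mul_indicator_preimage (X t) (φ (X s ω)) ω).symm
  simp_rw [h1]
  rw [integral_finsetSum _ fun y _ => hmul y, integral_finsetSum]
  · refine Finset.sum_congr rfl fun y _ => ?_
    rw [← integral_condExp (ℱ.le s)]
    refine integral_congr_ae ?_
    filter_upwards [condExp_mul_of_stronglyMeasurable_left (hg y) (hmul y) (hone y),
      hmark s t hst y] with ω h2 h3
    rw [h2, Pi.mul_apply, h3, mul_comm]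
  · intro y _
    exact integrable_comp_finite (hXm s)
      (fun x => NormedSpace.exp (((t : ℝ) - (s : ℝ)) • Q) x y * φ x y)

theorem condExp_comp_chain (hX : ∀ t, Measurable[ℱ t] (X t))
    (hmark : ∀ s t : ℝ≥0, s ≤ t → ∀ y : S,
      P[(X t ⁻¹' {y}).indicator (fun _ => (1 : ℝ)) | ℱ s] =ᵐ[P]
        fun ω => NormedSpace.exp (((t : ℝ) - (s : ℝ)) • Q) (X s ω) y)
    {s t : ℝ≥0} (hst : s ≤ t) (f : S → ℝ) :
    P[fun ω => f (X t ω) | ℱ s] =ᵐ[P]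
      fun ω => ∑ y, NormedSpace.exp (((t : ℝ) - (s : ℝ)) • Q) (X s ω) y * f y := by
  have hXm : ∀ t, Measurable (X t) := fun t => (hX t).mono (ℱ.le t) le_rfl
  have hone : ∀ y, Integrable ((X t ⁻¹' {y}).indicator fun _ => (1 : ℝ)) P := fun y =>
    (integrable_const 1).indicator (hXm t (measurableSet_singleton y))
  have h1 : (fun ω => f (X t ω)) =
      ∑ y, f y • (X t ⁻¹' {y}).indicator fun _ => (1 : ℝ) := by
    ext ω
    rw [Finset.sum_apply, ← sum_mul_indicator_preimage (X t) f ω]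
    rfl
  rw [h1]
  refine (condExp_finsetSum (fun y _ => (hone y).smul (f y)) _).trans ?_
  have h2 : ∀ᵐ ω ∂P, ∀ y, (P[f y • (X t ⁻¹' {y}).indicator (fun _ => (1 : ℝ)) | ℱ s]) ω =
      NormedSpace.exp (((t : ℝ) - (s : ℝ)) • Q) (X s ω) y * f y := by
    rw [ae_all_iff]
    intro y
    filter_upwards [condExp_smul (f y) ((X t ⁻¹' {y}).indicator fun _ => (1 : ℝ)) (ℱ s) (μ := P),
      hmark s t hst y] with ω h3 h4
    rw [h3, Pi.smul_apply, h4, smul_eq_mul, mul_comm]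
  filter_upwards [h2] with ω h3
  rw [Finset.sum_apply]
  exact Finset.sum_congr rfl fun y _ => h3 y

/-- On a fine grid of mesh `h`, `f (X t)` is uniformly close to the Riemann sums of
`f (X 0) + ∫ Q f (X s) ds`, with an error controlled by the carré du champ of `f`. -/
theorem IsCTMC.eventually_measure_le {q : S → S → ℝ} (hX : IsCTMC P (generator q) X)
    (f : S → ℝ) {Γ : ℝ}
    (hΓ : ∀ x, ∑ y, q x y * (f y - f x) ^ 2 ≤ Γ) {η : ℝ} (hη : 0 < η) :
    ∀ᶠ h : ℝ≥0 in 𝓝[>] 0, ∀ n : ℕ, ∀ δ : ℝ, 0 < δ →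
      P {ω | ∃ j ≤ n, δ + n * h * η ≤ |f (X (j * h) ω) - f (X 0 ω) -
        h * ∑ i ∈ Finset.range j, ∑ y, q (X (i * h) ω) y * (f y - f (X (i * h) ω))|} ≤
        ENNReal.ofReal (n * h * (Γ + η) / δ ^ 2) := by
  obtain ⟨ℱ, hXa, hmark⟩ := hX.markov
  have hXm : ∀ t, Measurable (X t) := fun t => (hXa t).mono (ℱ.le t) le_rfl
  set B : ℝ := ∑ y, |f y| with hB
  have hB0 : 0 ≤ B := Finset.sum_nonneg fun _ _ => abs_nonneg _
  have hfB : ∀ y, |f y| ≤ B := fun y =>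
    Finset.single_le_sum (f := fun y => |f y|) (fun y _ => abs_nonneg _) (Finset.mem_univ y)
  set c : ℝ := (Fintype.card S : ℝ) with hcdef
  have hc : 0 ≤ c := Nat.cast_nonneg _
  -- Small enough to absorb both the drift error `η' * B` and the quadratic error `η' * c * (2 * B)
  -- ^ 2`.
  set η' : ℝ := η / (B + c * (2 * B) ^ 2 + 1) with hη'
  have hden : 0 < B + c * (2 * B) ^ 2 + 1 := by positivity
  have hη'0 : 0 < η' := div_pos hη hden
  have hη'B : η' * B ≤ η := by
    rw [hη', div_mul_eq_mul_div, div_le_iff₀ hden]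
    have : 0 ≤ c * (2 * B) ^ 2 := by positivity
    nlinarith
  have hη'c : η' * (c * (2 * B) ^ 2) ≤ η := by
    rw [hη', div_mul_eq_mul_div, div_le_iff₀ hden]
    nlinarith
  have hcoe : Tendsto (fun h : ℝ≥0 => (h : ℝ)) (𝓝[>] 0) (𝓝[>] 0) :=
    tendsto_nhdsWithin_of_tendsto_nhds_of_eventually_within _
      ((NNReal.continuous_coe.tendsto' 0 0 rfl).mono_left nhdsWithin_le_nhds)
      (by filter_upwards [self_mem_nhdsWithin] with h hh using NNReal.coe_pos.2 hh)
  filter_upwards [hcoe.eventually (exp_smul_entry_sub_le (generator q) hη'0),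
    self_mem_nhdsWithin] with h hexp hh n δ hδ
  have hh0 : (0 : ℝ) < h := NNReal.coe_pos.2 hh
  set p : S → S → ℝ := fun x y => NormedSpace.exp ((h : ℝ) • generator q) x y with hp
  set pf : S → ℝ := fun x => ∑ y, p x y * f y with hpf
  have hsub : ∀ j : ℕ, (((((j + 1 : ℕ) : ℝ≥0) * h : ℝ≥0) : ℝ) - ((j * h : ℝ≥0) : ℝ)) = h := by
    intro j; push_cast; ring
  have hle : ∀ j : ℕ, (j : ℝ≥0) * h ≤ ((j + 1 : ℕ) : ℝ≥0) * h := fun j => by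
    gcongr; exact Nat.le_succ j
  have hpair : ∀ (j : ℕ) (φ : S → S → ℝ),
      ∫ ω, φ (X (j * h) ω) (X ((j + 1 : ℕ) * h) ω) ∂P =
        ∫ ω, ∑ y, p (X (j * h) ω) y * φ (X (j * h) ω) y ∂P := fun j φ => by
    have := integral_comp_pair hXa hmark (hle j) φ
    rwa [hsub] at this
  have hce : ∀ j : ℕ, P[fun ω => f (X ((j + 1 : ℕ) * h) ω) | ℱ (j * h)] =ᵐ[P]
      fun ω => pf (X (j * h) ω) := fun j => by
    have := condExp_comp_chain hXa hmark (hle j) f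
    rwa [hsub] at this
  -- one-step estimates
  have hdrift : ∀ x, |pf x - f x - h * ∑ y, q x y * (f y - f x)| ≤ η * h := by
    intro x
    have h1 : pf x - f x - h * ∑ y, q x y * (f y - f x) =
        ∑ y, (p x y - ((1 : Matrix S S ℝ) x y + h * generator q x y)) * f y := by
      have : ∑ y, (1 : Matrix S S ℝ) x y * f y = f x := by
        simp [Matrix.one_apply]
      simp only [sub_mul, add_mul, Finset.sum_sub_distrib, Finset.sum_add_distrib, this, mul_assoc,
        ← Finset.mul_sum, generator_mulVec]
      simp only [hpf]; ring
    rw [h1]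
    refine (Finset.abs_sum_le_sum_abs _ _).trans ?_
    calc _ ≤ ∑ y, η' * h * |f y| := Finset.sum_le_sum fun y _ => by
          rw [abs_mul]; exact mul_le_mul_of_nonneg_right (hexp x y) (abs_nonneg _)
      _ = (η' * B) * h := by rw [← Finset.mul_sum]; ring
      _ ≤ η * h := by gcongr
  have hsq : ∀ x, ∑ y, p x y * (f y - f x) ^ 2 ≤ h * (Γ + η) := by
    intro x
    have h1 : ∀ y, p x y * (f y - f x) ^ 2 ≤ h * (q x y * (f y - f x) ^ 2) +
        η' * h * (2 * B) ^ 2 := by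
      intro y
      -- The diagonal entry of `p` is close to `1`, but it multiplies `(f x - f x) ^ 2 = 0`; only
      -- the small off-diagonal entries matter.
      by_cases hxy : x = y
      · subst hxy; simp; positivity
      have h2 : p x y ≤ h * q x y + η' * h := by
        have := (abs_le.1 (hexp x y)).2
        simp only [generator, Matrix.one_apply, Matrix.of_apply, if_neg hxy] at this
        simp only [hp, generator]; linarith
      have h3 : (f y - f x) ^ 2 ≤ (2 * B) ^ 2 := by
        rw [← sq_abs]
        refine pow_le_pow_left₀ (abs_nonneg _) ?_ 2
        have := abs_sub (f y) (f x)
        linarith [hfB y, hfB x]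
      calc _ ≤ (h * q x y + η' * h) * (f y - f x) ^ 2 :=
            mul_le_mul_of_nonneg_right h2 (sq_nonneg _)
        _ ≤ _ := by rw [add_mul, mul_assoc (h : ℝ)]; gcongr
    calc _ ≤ ∑ y, (h * (q x y * (f y - f x) ^ 2) + η' * h * (2 * B) ^ 2) :=
          Finset.sum_le_sum fun y _ => h1 y
      _ = h * ∑ y, q x y * (f y - f x) ^ 2 + h * (η' * (c * (2 * B) ^ 2)) := by
          rw [Finset.sum_add_distrib, ← Finset.mul_sum, Finset.sum_const, nsmul_eq_mul,
            Finset.card_univ]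
          ring
      _ ≤ h * (Γ + η) := by
          rw [mul_add]
          exact add_le_add (mul_le_mul_of_nonneg_left (hΓ x) hh0.le)
            (mul_le_mul_of_nonneg_left hη'c hh0.le)
  -- the martingale differences
  set d : ℕ → Ω → ℝ := fun j ω => f (X ((j + 1 : ℕ) * h) ω) - pf (X (j * h) ω) with hd
  set B' : ℝ := ∑ y, |pf y| with hB'
  have hpfB : ∀ y, |pf y| ≤ B' := fun y =>
    Finset.single_le_sum (f := fun y => |pf y|) (fun y _ => abs_nonneg _) (Finset.mem_univ y)
  have hmax := measure_exists_le_abs_sum_le (μ := P) (𝒢 := gridFiltration ℱ h) (d := d)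
    (C := B + B') (V := h * (Γ + η)) ?_ ?_ ?_ ?_ n hδ
  · refine (measure_mono ?_).trans (hmax.trans_eq (by congr 2; ring))
    rintro ω ⟨j, hj, hω⟩
    refine ⟨j, hj, ?_⟩
    -- Martingale part plus `j` one-step drift errors, each at most `η * h`.
    have h1 : f (X (j * h) ω) - f (X 0 ω) -
        h * ∑ i ∈ Finset.range j, ∑ y, q (X (i * h) ω) y * (f y - f (X (i * h) ω)) =
        ∑ i ∈ Finset.range j, d i ω + ∑ i ∈ Finset.range j, (pf (X (i * h) ω) - f (X (i * h) ω) -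
          h * ∑ y, q (X (i * h) ω) y * (f y - f (X (i * h) ω))) := by
      have h2 := Finset.sum_range_sub (fun i : ℕ => f (X (i * h) ω)) j
      simp only [Nat.cast_zero, zero_mul] at h2
      rw [← h2, ← Finset.sum_add_distrib, Finset.mul_sum, ← Finset.sum_sub_distrib]
      refine Finset.sum_congr rfl fun i _ => ?_
      simp only [hd]; ring
    rw [h1] at hω
    have h3 : |∑ i ∈ Finset.range j, (pf (X (i * h) ω) - f (X (i * h) ω) -
        h * ∑ y, q (X (i * h) ω) y * (f y - f (X (i * h) ω)))| ≤ n * h * η := by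
      refine (Finset.abs_sum_le_sum_abs _ _).trans ((Finset.sum_le_sum fun (i : ℕ) _ =>
        hdrift (X (i * h) ω)).trans ?_)
      rw [Finset.sum_const, Finset.card_range, nsmul_eq_mul]
      have : (j : ℝ) ≤ n := by exact_mod_cast hj
      calc (j : ℝ) * (η * h) ≤ n * (η * h) := by gcongr
        _ = n * h * η := by ring
    have h4 := abs_add_le (∑ i ∈ Finset.range j, d i ω) (∑ i ∈ Finset.range j,
      (pf (X (i * h) ω) - f (X (i * h) ω) -
          h * ∑ y, q (X (i * h) ω) y * (f y - f (X (i * h) ω))))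
    linarith
  · intro i
    refine StronglyMeasurable.sub ?_ ?_
    · exact ((measurable_of_finite f).comp (hXa _)).stronglyMeasurable
    · exact (((measurable_of_finite pf).comp (hXa _)).mono (ℱ.mono (hle i)) le_rfl).stronglyMeasurable
  · intro i ω
    exact (abs_sub _ _).trans (add_le_add (hfB _) (hpfB _))
  · intro i
    have hint1 := integrable_comp_finite (P := P) (hXm ((i + 1 : ℕ) * h)) f
    have hint2 := integrable_comp_finite (P := P) (hXm (i * h)) pf
    have h5 : P[fun ω => pf (X (i * h) ω) | ℱ (i * h)] = fun ω => pf (X (i * h) ω) :=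
      condExp_of_stronglyMeasurable (ℱ.le _)
        ((measurable_of_finite pf).comp (hXa _)).stronglyMeasurable hint2
    filter_upwards [condExp_sub hint1 hint2 (ℱ (i * h)), hce i] with ω h6 h7
    change (P[(fun ω => f (X ((i + 1 : ℕ) * h) ω)) - fun ω => pf (X (i * h) ω) | ℱ (i * h)]) ω = 0
    rw [h6, Pi.sub_apply, h7, h5, sub_self]
  · intro i
    have hI : ∀ g : S → S → ℝ, Integrable (fun ω => g (X (i * h) ω) (X ((i + 1 : ℕ) * h) ω)) P :=
      fun g => integrable_comp_finite (P := P) (S := S × S)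
        ((hXm (i * h)).prodMk (hXm ((i + 1 : ℕ) * h))) fun z => g z.1 z.2
    -- Pythagoras: since `pf` is the conditional mean, the variance of the increment is at most the
    -- second moment of `f (X') - f (X)`, which `hsq` bounds.
    have hcross : ∫ ω, (f (X ((i + 1 : ℕ) * h) ω) - pf (X (i * h) ω)) *
        (pf (X (i * h) ω) - f (X (i * h) ω)) ∂P = 0 := by
      simp only [sub_mul]
      rw [integral_sub (hI fun x y => f y * (pf x - f x)) (hI fun x y => pf x * (pf x - f x)),
        hpair i fun x y => f y * (pf x - f x)]
      simp only [hpf, ← mul_assoc, ← Finset.sum_mul, sub_self]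
    calc ∫ ω, d i ω ^ 2 ∂P
        ≤ ∫ ω, d i ω ^ 2 ∂P + ∫ ω, (pf (X (i * h) ω) - f (X (i * h) ω)) ^ 2 ∂P :=
          le_add_of_nonneg_right (integral_nonneg fun ω => sq_nonneg _)
      _ = ∫ ω, (f (X ((i + 1 : ℕ) * h) ω) - f (X (i * h) ω)) ^ 2 ∂P := by
          have h8 : ∀ ω, (f (X ((i + 1 : ℕ) * h) ω) - f (X (i * h) ω)) ^ 2 =
              (d i ω ^ 2 + (pf (X (i * h) ω) - f (X (i * h) ω)) ^ 2) +
              2 * ((f (X ((i + 1 : ℕ) * h) ω) - pf (X (i * h) ω)) *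
                (pf (X (i * h) ω) - f (X (i * h) ω))) := fun ω => by
            simp only [hd]; ring
          simp only [h8]
          rw [integral_add, integral_add, integral_const_mul, hcross, mul_zero, add_zero]
          · exact hI fun x y => (f y - pf x) ^ 2
          · exact hI fun x y => (pf x - f x) ^ 2
          · exact hI fun x y => (f y - pf x) ^ 2 + (pf x - f x) ^ 2
          · exact hI fun x y => 2 * ((f y - pf x) * (pf x - f x))
      _ = ∫ ω, ∑ y, p (X (i * h) ω) y * (f y - f (X (i * h) ω)) ^ 2 ∂P :=
          hpair i fun x y => (f y - f x) ^ 2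
      _ ≤ ∫ _, h * (Γ + η) ∂P :=
          integral_mono (integrable_comp_finite (hXm _) fun x => ∑ y, p x y * (f y - f x) ^ 2)
            (integrable_const _) fun ω => hsq _
      _ = h * (Γ + η) := by simp

end Chain

/-! ### A discrete Grönwall inequality for an infinite hierarchy -/

/-- The induction runs on the right-hand side of `hD`, which grows at each step by a factor of at
most `1 + L`. -/
theorem le_mul_exp_of_le_add_sum {D : ℕ → ℝ} {A L : ℝ} {n : ℕ} (hL : 0 ≤ L)
    (hA : 0 ≤ A) (hD : ∀ j ≤ n, D j ≤ A + L * ∑ i ∈ Finset.range j, D i) :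
    ∀ j ≤ n, D j ≤ A * Real.exp (L * n) := by
  have key : ∀ j ≤ n, A + L * ∑ i ∈ Finset.range j, D i ≤ A * (1 + L) ^ j := by
    intro j
    induction j with
    | zero => intro _; simp
    | succ j ih =>
      intro hj
      have h1 := ih (by omega)
      have h2 := (hD j (by omega)).trans h1
      rw [Finset.sum_range_succ, pow_succ]
      nlinarith [mul_le_mul_of_nonneg_left h2 hL]
  intro j hj
  refine ((hD j hj).trans (key j hj)).trans (mul_le_mul_of_nonneg_left ?_ hA)
  calc (1 + L) ^ j ≤ (1 + L) ^ n := pow_le_pow_right₀ (by linarith) hj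
    _ ≤ Real.exp L ^ n := by
        gcongr
        rw [add_comm]; exact Real.add_one_le_exp L
    _ = Real.exp (L * n) := by rw [← Real.exp_nat_mul, mul_comm]

/-- A Grönwall inequality for a hierarchy in which each level is controlled by the next one: the
hierarchy is truncated at level `m`, and the levels are summed with weights `2 ^ (-a)`. -/
theorem hierarchy_gronwall {S : ℕ → ℕ → ℝ} {L δ B : ℝ} {n m : ℕ} (hS : ∀ a j, 0 ≤ S a j)
    (hSB : ∀ a j, S a j ≤ B) (hL : 0 ≤ L) (hδ : 0 ≤ δ)
    (hrec : ∀ a ≤ m, ∀ j ≤ n, S a j ≤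
      δ + L * ∑ i ∈ Finset.range j, (S (a + 1) i + S a i + S 0 i)) :
    ∀ j ≤ n, S 0 j ≤ (2 * δ + L * n * (B / 2 ^ m)) * Real.exp (5 * L * n) := by
  set w : ℕ → ℝ := fun a => (1 / 2) ^ a with hw
  have hw0 : ∀ a, 0 ≤ w a := fun a => by positivity
  have hB : 0 ≤ B := (hS 0 0).trans (hSB 0 0)
  set D : ℕ → ℝ := fun j => ∑ a ∈ Finset.range (m + 1), w a * S a j with hD
  have hSD : ∀ j, S 0 j ≤ D j := fun j => by
    have := Finset.single_le_sum (f := fun a => w a * S a j)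
      (fun a _ => mul_nonneg (hw0 a) (hS a j)) (Finset.mem_range.2 (Nat.succ_pos m))
    simpa [hw, hD] using this
  have hw2 : ∑ a ∈ Finset.range (m + 1), w a ≤ 2 := sum_geometric_two_le _
  -- Shifting the level costs the weight ratio `2` and one term at level `m + 1`, where only the a
  -- priori bound `B` is available.
  have hnext : ∀ i, ∑ a ∈ Finset.range (m + 1), w a * S (a + 1) i ≤ 2 * D i + B / 2 ^ m := by
    intro i
    have h1 : ∑ a ∈ Finset.range (m + 1), w a * S (a + 1) i =
        2 * ∑ a ∈ Finset.range (m + 1), w (a + 1) * S (a + 1) i := by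
      rw [Finset.mul_sum]
      refine Finset.sum_congr rfl fun a _ => ?_
      simp only [hw, pow_succ]; ring
    have h2 : ∑ a ∈ Finset.range (m + 1), w (a + 1) * S (a + 1) i + w 0 * S 0 i =
        D i + w (m + 1) * S (m + 1) i := by
      rw [← Finset.sum_range_succ' (fun a => w a * S a i), Finset.sum_range_succ]
    have h3 : 2 * (w (m + 1) * S (m + 1) i) ≤ B / 2 ^ m := by
      have h4 : 2 * (w (m + 1) * S (m + 1) i) = S (m + 1) i / 2 ^ m := by
        simp only [hw, pow_succ, div_pow, one_pow]; field_simp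
      rw [h4]
      gcongr
      exact hSB _ _
    have h5 := mul_nonneg (hw0 0) (hS 0 i)
    linarith
  have hDrec : ∀ j ≤ n, D j ≤ (2 * δ + L * n * (B / 2 ^ m)) +
      5 * L * ∑ i ∈ Finset.range j, D i := by
    intro j hj
    have h1 : D j ≤ ∑ a ∈ Finset.range (m + 1), w a *
        (δ + L * ∑ i ∈ Finset.range j, (S (a + 1) i + S a i + S 0 i)) :=
      Finset.sum_le_sum fun a ha => mul_le_mul_of_nonneg_left
        (hrec a (Nat.lt_succ_iff.1 (Finset.mem_range.1 ha)) j hj) (hw0 a)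
    have h2 : ∑ a ∈ Finset.range (m + 1), w a *
        (δ + L * ∑ i ∈ Finset.range j, (S (a + 1) i + S a i + S 0 i)) =
        (∑ a ∈ Finset.range (m + 1), w a) * δ + L * ∑ i ∈ Finset.range j,
          ∑ a ∈ Finset.range (m + 1), w a * (S (a + 1) i + S a i + S 0 i) := by
      rw [Finset.sum_comm, Finset.sum_mul, Finset.mul_sum, ← Finset.sum_add_distrib]
      refine Finset.sum_congr rfl fun a _ => ?_
      rw [mul_add, ← Finset.mul_sum]; ring
    -- The constant `5` is `2` from the next level, `1` from the level itself, and `2` from level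
    -- `0`, which is counted with the total weight.
    have h3 : ∀ i, ∑ a ∈ Finset.range (m + 1), w a * (S (a + 1) i + S a i + S 0 i) ≤
        5 * D i + B / 2 ^ m := by
      intro i
      simp only [mul_add, Finset.sum_add_distrib, ← Finset.sum_mul]
      have h4 : (∑ a ∈ Finset.range (m + 1), w a) * S 0 i ≤ 2 * D i :=
        mul_le_mul hw2 (hSD i) (hS 0 i) (by norm_num)
      have h5 : ∑ a ∈ Finset.range (m + 1), w a * S a i = D i := rfl
      linarith [hnext i]
    have h6 : ∑ i ∈ Finset.range j,
        ∑ a ∈ Finset.range (m + 1), w a * (S (a + 1) i + S a i + S 0 i) ≤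
        5 * ∑ i ∈ Finset.range j, D i + n * (B / 2 ^ m) := by
      refine (Finset.sum_le_sum fun i _ => h3 i).trans ?_
      rw [Finset.sum_add_distrib, ← Finset.mul_sum, Finset.sum_const, Finset.card_range,
        nsmul_eq_mul]
      gcongr
    have h7 := mul_le_mul_of_nonneg_left h6 hL
    have h8 := mul_le_mul_of_nonneg_right hw2 hδ
    linarith
  intro j hj
  exact (hSD j).trans (le_mul_exp_of_le_add_sum (by positivity) (by positivity) hDrec j hj)

/-! ### The generator of the bike-sharing chain on the moments of the empirical measure -/

/-- Rate of change of `1_k` when a bike is taken at a station with `n` bikes. -/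
def takeCoef {K : ℕ} (k n : Fin (K + 1)) : ℝ :=
  if 0 < (n : ℕ) then (if (k : ℕ) + 1 = n then 1 else 0) - (if k = n then 1 else 0) else 0

/-- Rate of change of `1_k` when a bike is returned at a station with `n` bikes. -/
def returnCoef {K : ℕ} (k n : Fin (K + 1)) : ℝ :=
  if (n : ℕ) < K then (if (k : ℕ) = n + 1 then 1 else 0) - (if k = n then 1 else 0) else 0

theorem abs_takeCoef_le {K : ℕ} (k n : Fin (K + 1)) : |takeCoef k n| ≤ 1 := by
  unfold takeCoef
  split_ifs <;> simp

theorem abs_returnCoef_le {K : ℕ} (k n : Fin (K + 1)) : |returnCoef k n| ≤ 1 := by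
  unfold returnCoef
  split_ifs <;> simp

theorem takeCoef_nonneg {K : ℕ} {k n : Fin (K + 1)} (h : k ≠ n) : 0 ≤ takeCoef k n := by
  unfold takeCoef
  split_ifs <;> simp_all

theorem returnCoef_nonneg {K : ℕ} {k n : Fin (K + 1)} (h : k ≠ n) : 0 ≤ returnCoef k n := by
  unfold returnCoef
  split_ifs <;> simp_all

/-- Duality with a test function of the number of bikes. The case `g = 1` is conservation of mass;
`g k = k` shows that departures lower the mean number of bikes. -/
theorem sum_mul_takeCoef {K : ℕ} (g : ℕ → ℝ) (n : Fin (K + 1)) :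
    ∑ k : Fin (K + 1), g k * takeCoef k n = if 0 < (n : ℕ) then g (n - 1) - g n else 0 := by
  unfold takeCoef
  by_cases h : 0 < (n : ℕ)
  · simp only [if_pos h, mul_sub, Finset.sum_sub_distrib, mul_ite, mul_one, mul_zero, Finset.sum_ite_eq',
      Finset.mem_univ, if_true]
    congr 1
    rw [Finset.sum_eq_single (⟨n - 1, by omega⟩ : Fin (K + 1))]
    · rw [if_pos (Nat.sub_add_cancel h)]
    · intro b _ hb
      rw [if_neg]
      intro h2
      exact hb (Fin.ext (by simp; omega))
    · simp
  · simp [h]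

theorem sum_mul_returnCoef {K : ℕ} (g : ℕ → ℝ) (n : Fin (K + 1)) :
    ∑ k : Fin (K + 1), g k * returnCoef k n = if (n : ℕ) < K then g (n + 1) - g n else 0 := by
  unfold returnCoef
  by_cases h : (n : ℕ) < K
  · simp only [if_pos h, mul_sub, Finset.sum_sub_distrib, mul_ite, mul_one, mul_zero, Finset.sum_ite_eq',
      Finset.mem_univ, if_true]
    congr 1
    rw [Finset.sum_eq_single (⟨n + 1, by omega⟩ : Fin (K + 1))]
    · rw [if_pos rfl]
    · intro b _ hb
      rw [if_neg]
      intro h2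
      exact hb (Fin.ext (by simp; omega))
    · simp
  · simp [h]

theorem sum_takeCoef {K : ℕ} (n : Fin (K + 1)) : ∑ k : Fin (K + 1), takeCoef k n = 0 := by
  simpa using sum_mul_takeCoef (fun _ => 1) n

theorem sum_returnCoef {K : ℕ} (n : Fin (K + 1)) : ∑ k : Fin (K + 1), returnCoef k n = 0 := by
  simpa using sum_mul_returnCoef (fun _ => 1) n

theorem drift_eq {K : ℕ} (Λ γ : ℝ) (y : Fin (K + 1) → Measure ℝ) (B : Set ℝ) (k : Fin (K + 1)) :
    drift Λ γ y B k = ∑ n, (takeCoef k n * ∫ r in B, Λ / r ∂(y n) +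
      returnCoef k n * ((γ - meanBikes y) * (y n).real B)) := by
  unfold drift takeCoef returnCoef
  refine Finset.sum_congr rfl fun n _ => ?_
  split_ifs <;> ring

/-- The integral of `θ ^ a` over the stations with `k` bikes, for the empirical measure. -/
def moment {K N : ℕ} (θ : Fin N → ℝ) (a : ℕ) (k : Fin (K + 1)) (x : State K N) : ℝ :=
  (1 / (N : ℝ)) * ∑ i, θ i ^ a * if x i = k then 1 else 0

/-- The states agreeing with `x` off `i` are parametrized by their value at `i`; this turns a sum
over states into a sum over one station's content. -/
theorem sum_ite_update {K N : ℕ} (x : State K N) (i : Fin N) (R : Fin (K + 1) → Prop)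
    [DecidablePred R] (c : ℝ) (G : State K N → ℝ) :
    ∑ y : State K N, (if R (y i) ∧ ∀ j, j ≠ i → y j = x j then c else 0) * G y =
      ∑ v, (if R v then c else 0) * G (Function.update x i v) := by
  symm
  refine Finset.sum_of_injOn (Function.update x i) ((Function.update_injective x i).injOn)
    (fun _ _ => by simp) ?_ ?_
  · intro y _ hy
    rw [if_neg, zero_mul]
    rintro ⟨_, h⟩
    refine hy ⟨y i, by simp, ?_⟩
    ext j
    by_cases hj : j = i
    · subst hj; simp
    · simp [Function.update_of_ne hj, h j hj]
  · intro v _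
    congr 1
    have : ∀ j, j ≠ i → Function.update x i v j = x j := fun j hj => Function.update_of_ne hj _ _
    simp only [Function.update_self]
    exact if_congr (and_iff_left this).symm rfl rfl

theorem sum_jumpRate_mul {K N : ℕ} (M : ℕ) (lam : Fin N → ℝ) (x : State K N)
    (G : State K N → ℝ) :
    ∑ y, jumpRate M lam x y * G y = ∑ i, ∑ v : Fin (K + 1),
      ((if (v : ℕ) + 1 = x i then lam i else 0) + (if (v : ℕ) = x i + 1 then
        (1 / (N : ℝ)) * ((M - ∑ j, (x j : ℕ) : ℕ) : ℝ) else 0)) * G (Function.update x i v) := by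
  simp only [jumpRate, Finset.sum_mul]
  rw [Finset.sum_comm]
  refine Finset.sum_congr rfl fun i _ => ?_
  simp only [add_mul, Finset.sum_add_distrib]
  rw [sum_ite_update x i (fun v => (v : ℕ) + 1 = x i), sum_ite_update x i (fun v => (v : ℕ) = x i + 1)]

theorem moment_update_sub {K N : ℕ} (θ : Fin N → ℝ) (a : ℕ) (k : Fin (K + 1)) (x : State K N)
    (i : Fin N) (v : Fin (K + 1)) :
    moment θ a k (Function.update x i v) - moment θ a k x =
      (1 / (N : ℝ)) * (θ i ^ a * ((if v = k then 1 else 0) - (if x i = k then 1 else 0))) := by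
  unfold moment
  rw [← mul_sub, ← Finset.sum_sub_distrib, Finset.sum_eq_single i]
  · simp only [Function.update_self]; ring
  · intro j _ hj
    simp [Function.update_of_ne hj]
  · simp

theorem sum_take_eq {K : ℕ} (k n : Fin (K + 1)) (c : ℝ) :
    ∑ v : Fin (K + 1), (if (v : ℕ) + 1 = n then c else 0) *
      ((if v = k then 1 else 0) - (if n = k then 1 else 0)) = c * takeCoef k n := by
  by_cases hn : 0 < (n : ℕ)
  · rw [Finset.sum_eq_single ⟨n - 1, by omega⟩]
    · simp only [takeCoef, if_pos hn, if_pos (Nat.sub_add_cancel hn), Fin.ext_iff]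
      congr 2
      · refine if_congr ?_ rfl rfl; omega
      · refine if_congr ?_ rfl rfl; omega
    · intro b _ hb
      rw [if_neg, zero_mul]
      intro h2
      exact hb (Fin.ext (by simp; omega))
    · simp
  · simp only [takeCoef, if_neg hn, mul_zero]
    refine Finset.sum_eq_zero fun v _ => ?_
    rw [if_neg (by omega), zero_mul]

theorem sum_return_eq {K : ℕ} (k n : Fin (K + 1)) (c : ℝ) :
    ∑ v : Fin (K + 1), (if (v : ℕ) = n + 1 then c else 0) *
      ((if v = k then 1 else 0) - (if n = k then 1 else 0)) = c * returnCoef k n := by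
  by_cases hn : (n : ℕ) < K
  · rw [Finset.sum_eq_single ⟨n + 1, by omega⟩]
    · simp only [returnCoef, if_pos hn, if_true, Fin.ext_iff]
      congr 2
      · refine if_congr ?_ rfl rfl; omega
      · refine if_congr ?_ rfl rfl; omega
    · intro b _ hb
      rw [if_neg, zero_mul]
      intro h2
      exact hb (Fin.ext (by simp; omega))
    · simp
  · simp only [returnCoef, if_neg hn, mul_zero]
    refine Finset.sum_eq_zero fun v _ => ?_
    rw [if_neg (by omega), zero_mul]

/-- The generator on moments when the arrival rates are `c * θ i`. -/
theorem sum_jumpRate_moment {K N : ℕ} (M : ℕ) {lam θ : Fin N → ℝ} {c : ℝ}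
    (hlam : ∀ i, lam i = c * θ i) (a : ℕ) (k : Fin (K + 1)) (x : State K N) :
    ∑ y, jumpRate M lam x y * (moment θ a k y - moment θ a k x) =
      ∑ m, (takeCoef k m * (c * moment θ (a + 1) m x) + returnCoef k m *
        ((1 / (N : ℝ)) * ((M - ∑ j, (x j : ℕ) : ℕ) : ℝ) * moment θ a m x)) := by
  set ret : ℝ := (1 / (N : ℝ)) * ((M - ∑ j, (x j : ℕ) : ℕ) : ℝ)
  rw [sum_jumpRate_mul M lam x fun y => moment θ a k y - moment θ a k x]
  have h1 : ∀ i, ∑ v : Fin (K + 1), ((if (v : ℕ) + 1 = x i then lam i else 0) +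
      (if (v : ℕ) = x i + 1 then ret else 0)) *
        (moment θ a k (Function.update x i v) - moment θ a k x) =
      (1 / (N : ℝ)) * θ i ^ a * (lam i * takeCoef k (x i) + ret * returnCoef k (x i)) := by
    intro i
    rw [← sum_take_eq, ← sum_return_eq, ← Finset.sum_add_distrib, Finset.mul_sum]
    refine Finset.sum_congr rfl fun v _ => ?_
    rw [moment_update_sub]; ring
  rw [Finset.sum_congr rfl fun i _ => h1 i]
  have h2 : ∀ (g : Fin (K + 1) → ℝ) (b : ℕ), ∑ m, g m * moment θ b m x =
      ∑ i, (1 / (N : ℝ)) * (θ i ^ b * g (x i)) := by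
    intro g b
    simp only [moment, Finset.mul_sum]
    rw [Finset.sum_comm]
    refine Finset.sum_congr rfl fun i _ => ?_
    rw [Finset.sum_eq_single (x i)]
    · simp; ring
    · intro m _ hm
      rw [if_neg hm.symm]; ring
    · simp
  have h3 : ∀ m, takeCoef k m * (c * moment θ (a + 1) m x) + returnCoef k m *
      (ret * moment θ a m x) = c * (takeCoef k m * moment θ (a + 1) m x) +
        ret * (returnCoef k m * moment θ a m x) := fun m => by ring
  simp_rw [h3]
  rw [Finset.sum_add_distrib, ← Finset.mul_sum, ← Finset.mul_sum, h2, h2, Finset.mul_sum,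
    Finset.mul_sum, ← Finset.sum_add_distrib]
  refine Finset.sum_congr rfl fun i _ => ?_
  -- Here the rate `c * θ i` raises the order of the moment from `a` to `a + 1`.
  rw [hlam i]; ring

/-- The total jump rate is at most `N * (C + M / N)` and each jump moves the moment by at most `1 /
N`. -/
theorem sum_jumpRate_moment_sq_le {K N : ℕ} (hN : 0 < N) (M : ℕ) {lam θ : Fin N → ℝ} {C : ℝ}
    (hlam : ∀ i, 0 ≤ lam i) (hC : ∀ i, lam i ≤ C) (hθ : ∀ i, |θ i| ≤ 1) (a : ℕ)
    (k : Fin (K + 1)) (x : State K N) :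
    ∑ y, jumpRate M lam x y * (moment θ a k y - moment θ a k x) ^ 2 ≤ (C + M / N) / N := by
  have hN' : (0 : ℝ) < N := by exact_mod_cast hN
  set ret : ℝ := (1 / (N : ℝ)) * ((M - ∑ j, (x j : ℕ) : ℕ) : ℝ)
  have hret0 : 0 ≤ ret := by positivity
  have hret : ret ≤ M / N := by
    rw [div_eq_mul_one_div, mul_comm (M : ℝ)]
    refine mul_le_mul_of_nonneg_left ?_ (by positivity)
    exact_mod_cast Nat.sub_le _ _
  rw [sum_jumpRate_mul M lam x fun y => (moment θ a k y - moment θ a k x) ^ 2]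
  have h1 : ∀ i v, (moment θ a k (Function.update x i v) - moment θ a k x) ^ 2 ≤
      (1 / (N : ℝ)) ^ 2 := by
    intro i v
    rw [moment_update_sub, mul_pow]
    refine mul_le_of_le_one_right (by positivity) ?_
    rw [← sq_abs, abs_mul, abs_pow]
    refine pow_le_one₀ (by positivity) (mul_le_one₀ (pow_le_one₀ (abs_nonneg _) (hθ i))
      (abs_nonneg _) ?_)
    split_ifs <;> simp
  have hone : ∀ (R : Fin (K + 1) → Prop) [DecidablePred R] (c : ℝ), 0 ≤ c →
      (∀ v w, R v → R w → v = w) → ∑ v, (if R v then c else 0) ≤ c := by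
    intro R _ c hc hR
    by_cases h : ∃ v, R v
    · obtain ⟨v, hv⟩ := h
      rw [Finset.sum_eq_single v]
      · rw [if_pos hv]
      · intro w _ hw
        rw [if_neg fun h => hw (hR _ _ h hv)]
      · simp
    · push Not at h
      simp [h, hc]
  have h2 : ∀ i, ∑ v : Fin (K + 1), ((if (v : ℕ) + 1 = x i then lam i else 0) +
      (if (v : ℕ) = x i + 1 then ret else 0)) *
        (moment θ a k (Function.update x i v) - moment θ a k x) ^ 2 ≤
      (C + M / N) * (1 / (N : ℝ)) ^ 2 := by
    intro i
    calc _ ≤ ∑ v : Fin (K + 1), ((if (v : ℕ) + 1 = x i then lam i else 0) +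
          (if (v : ℕ) = x i + 1 then ret else 0)) * (1 / (N : ℝ)) ^ 2 := by
          refine Finset.sum_le_sum fun v _ => mul_le_mul_of_nonneg_left (h1 i v) ?_
          have := hlam i
          positivity
      _ = (∑ v : Fin (K + 1), (if (v : ℕ) + 1 = x i then lam i else 0) +
          ∑ v : Fin (K + 1), (if (v : ℕ) = x i + 1 then ret else 0)) * (1 / (N : ℝ)) ^ 2 := by
          rw [← Finset.sum_mul, Finset.sum_add_distrib]
      _ ≤ _ := by
          refine mul_le_mul_of_nonneg_right (add_le_add ?_ ?_) (by positivity)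
          · exact (hone (fun v => (v : ℕ) + 1 = x i) _ (hlam i)
              (fun v w hv hw => Fin.ext (by omega))).trans (hC i)
          · exact (hone (fun v => (v : ℕ) = x i + 1) _ hret0
              (fun v w hv hw => Fin.ext (by omega))).trans hret
  refine (Finset.sum_le_sum fun i _ => h2 i).trans_eq ?_
  rw [Finset.sum_const, Finset.card_univ, Fintype.card_fin, nsmul_eq_mul]
  field_simp

/-! ### Bounds and identities for moments. -/

theorem moment_nonneg {K N : ℕ} {θ : Fin N → ℝ} (hθ : ∀ i, 0 ≤ θ i) (a : ℕ) (k : Fin (K + 1))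
    (x : State K N) : 0 ≤ moment θ a k x :=
  mul_nonneg (by positivity) (Finset.sum_nonneg fun i _ =>
    mul_nonneg (pow_nonneg (hθ i) a) (by split_ifs <;> simp))

theorem moment_le_one {K N : ℕ} {θ : Fin N → ℝ} (hθ : ∀ i, 0 ≤ θ i) (hθ1 : ∀ i, θ i ≤ 1)
    (a : ℕ) (k : Fin (K + 1)) (x : State K N) : moment θ a k x ≤ 1 := by
  have h1 : ∑ i, θ i ^ a * (if x i = k then 1 else 0) ≤ (N : ℝ) := by
    refine (Finset.sum_le_sum (g := fun _ => (1 : ℝ)) fun i _ =>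
      mul_le_one₀ (pow_le_one₀ (hθ i) (hθ1 i)) ?_ ?_).trans ?_
    · split_ifs <;> simp
    · split_ifs <;> simp
    · simp
  unfold moment
  rcases Nat.eq_zero_or_pos N with rfl | hN
  · simp
  · have : (0 : ℝ) < N := by exact_mod_cast hN
    rw [one_div_mul_eq_div, div_le_one this]
    exact h1

theorem sum_mul_moment_zero {K N : ℕ} (θ : Fin N → ℝ) (x : State K N) :
    ∑ n : Fin (K + 1), (n : ℝ) * moment θ 0 n x = (1 / (N : ℝ)) * ∑ j, ((x j : ℕ) : ℝ) := by
  simp only [moment, pow_zero, one_mul, Finset.mul_sum]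
  rw [Finset.sum_comm]
  refine Finset.sum_congr rfl fun i _ => ?_
  rw [Finset.sum_eq_single (x i)]
  · simp; ring
  · intro m _ hm
    rw [if_neg hm.symm]; ring
  · simp

theorem sum_moment_zero {K N : ℕ} (hN : 0 < N) (θ : Fin N → ℝ) (x : State K N) :
    ∑ n, moment θ 0 n x = 1 := by
  have hN' : (N : ℝ) ≠ 0 := by exact_mod_cast hN.ne'
  simp only [moment, pow_zero, one_mul]
  rw [← Finset.mul_sum, Finset.sum_comm]
  simp [hN']

/-- The truncated subtraction becomes a positive part, valid at every state; hence no invariance of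
`∑ j, x j ≤ M` along the paths is needed later. -/
theorem return_rate_eq {K N : ℕ} (M : ℕ) (θ : Fin N → ℝ) (x : State K N) :
    (1 / (N : ℝ)) * ((M - ∑ j, (x j : ℕ) : ℕ) : ℝ) =
      max ((M : ℝ) / N - ∑ n : Fin (K + 1), (n : ℝ) * moment θ 0 n x) 0 := by
  have h2 : ((M - ∑ j, (x j : ℕ) : ℕ) : ℝ) = max ((M : ℝ) - ∑ j, ((x j : ℕ) : ℝ)) 0 := by
    rcases le_total (∑ j, (x j : ℕ)) M with h | h
    · have h' : (∑ j, ((x j : ℕ) : ℝ)) ≤ M := by exact_mod_cast h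
      rw [Nat.cast_sub h, max_eq_left (by linarith)]
      push_cast; ring
    · have h' : (M : ℝ) ≤ ∑ j, ((x j : ℕ) : ℝ) := by exact_mod_cast h
      rw [Nat.sub_eq_zero_of_le h, max_eq_right (by linarith)]
      simp
  rw [sum_mul_moment_zero, h2, mul_max_of_nonneg _ _ (by positivity)]
  congr 1
  · ring
  · simp

/-! ### Ordinary differential equations -/

/-- A bounded Lipschitz vector field has global forward solutions. -/
theorem exists_forall_hasDerivWithinAt_Ici {E : Type*} [NormedAddCommGroup E] [NormedSpace ℝ E]
    [CompleteSpace E] {v : E → E} {K L : ℝ≥0} (hv : LipschitzWith K v) (hL : ∀ x, ‖v x‖ ≤ L)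
    (x₀ : E) :
    ∃ p : ℝ → E, p 0 = x₀ ∧ ∀ t, 0 ≤ t → HasDerivWithinAt p (v (p t)) (Ici 0) t := by
  have hex : ∀ T : ℕ, ∃ α : ℝ → E, α 0 = x₀ ∧
      ∀ t ∈ Icc (0 : ℝ) T, HasDerivWithinAt α (v (α t)) (Icc (0 : ℝ) T) t := by
    intro T
    have hT : (0 : ℝ) ∈ Icc (0 : ℝ) T := ⟨le_rfl, Nat.cast_nonneg T⟩
    -- At speed at most `L`, a solution cannot leave the ball of radius `L * T` before time `T`, so
    -- there is no restriction on `T`.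
    have hPL : IsPicardLindelof (fun _ => v) (⟨0, hT⟩ : Icc (0 : ℝ) T) x₀ (L * T) 0 L K :=
      { lipschitzOnWith := fun _ _ => hv.lipschitzOnWith
        continuousOn := fun _ _ => continuousOn_const
        norm_le := fun _ _ x _ => hL x
        mul_max_le := by simp }
    exact hPL.exists_eq_forall_mem_Icc_hasDerivWithinAt₀
  choose α hα0 hα using hex
  have hright : ∀ (T : ℕ) (t : ℝ), t ∈ Ico (0 : ℝ) T → HasDerivWithinAt (α T) (v (α T t)) (Ici t) t :=
    fun T t ht => ((hα T t ⟨ht.1, ht.2.le⟩).mono (Icc_subset_Icc_left ht.1)).mono_of_mem_nhdsWithin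
      (Icc_mem_nhdsGE ht.2)
  have hcont : ∀ T : ℕ, ContinuousOn (α T) (Icc (0 : ℝ) T) := fun T t ht =>
    (hα T t ht).continuousWithinAt
  have hagree : ∀ (S T : ℕ), S ≤ T → ∀ t ∈ Icc (0 : ℝ) S, α S t = α T t := by
    intro S T hST
    have hST' : (S : ℝ) ≤ T := by exact_mod_cast hST
    exact ODE_solution_unique_of_mem_Icc_right (v := fun _ => v) (s := fun _ => univ) (K := K)
      (fun _ _ => hv.lipschitzOnWith) (hcont S) (hright S) (fun _ _ => mem_univ _)
      ((hcont T).mono (Icc_subset_Icc_right hST'))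
      (fun t ht => hright T t ⟨ht.1, ht.2.trans_le hST'⟩) (fun _ _ => mem_univ _)
      (by rw [hα0, hα0])
  have heq : ∀ (T : ℕ) (t : ℝ), t ∈ Icc (0 : ℝ) T → α ⌈t⌉₊ t = α T t := fun T t ht =>
    hagree _ _ (Nat.ceil_le.2 ht.2) t ⟨ht.1, Nat.le_ceil t⟩
  refine ⟨fun t => α ⌈t⌉₊ t, by simpa using hα0 0, fun t ht => ?_⟩
  -- One more than the ceiling, so that `t < T` and the glued function agrees with the single
  -- solution `α T` near `t`.
  set T : ℕ := ⌈t⌉₊ + 1 with hT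
  have htT : t < T := by
    have := Nat.le_ceil t
    rw [hT]; push_cast; linarith
  have h1 : HasDerivWithinAt (α T) (v (α T t)) (Ici 0) t :=
    (hα T t ⟨ht, htT.le⟩).mono_of_mem_nhdsWithin
      (mem_nhdsWithin.2 ⟨Iio (T : ℝ), isOpen_Iio, htT, fun s hs => ⟨hs.2, le_of_lt hs.1⟩⟩)
  have h2 : (fun s => α ⌈s⌉₊ s) =ᶠ[𝓝[Ici 0] t] α T :=
    mem_nhdsWithin.2 ⟨Iio (T : ℝ), isOpen_Iio, htT, fun s hs => heq T s ⟨hs.2, le_of_lt hs.1⟩⟩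
  have h3 : α ⌈t⌉₊ t = α T t := heq T t ⟨ht, htT.le⟩
  simp only [h3]
  exact h1.congr_of_eventuallyEq h2 h3

theorem HasDerivWithinAt.mono_Ici {E : Type*} [NormedAddCommGroup E] [NormedSpace ℝ E]
    {f : ℝ → E} {f' : E} {t : ℝ} (h : HasDerivWithinAt f f' (Ici 0) t) (ht : 0 ≤ t) :
    HasDerivWithinAt f f' (Ici t) t :=
  h.mono (Ici_subset_Ici.2 ht)

/-- A function that does not decrease where it is negative stays nonnegative. -/
theorem nonneg_of_deriv_nonneg_of_neg {f f' : ℝ → ℝ} (h0 : 0 ≤ f 0)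
    (hf : ∀ t, 0 ≤ t → HasDerivWithinAt f (f' t) (Ici 0) t)
    (hneg : ∀ t, 0 ≤ t → f t < 0 → 0 ≤ f' t) {t : ℝ} (ht : 0 ≤ t) : 0 ≤ f t := by
  -- The barrier `ε * (1 + s)` has slope `ε > 0`; at a contact point `f < 0`, hence `-f' ≤ 0 < ε`,
  -- and `-f` cannot cross it.
  have key : ∀ ε : ℝ, 0 < ε → -f t ≤ ε * (1 + t) := by
    intro ε hε
    refine image_le_of_deriv_right_lt_deriv_boundary (f := fun s => -f s) (f' := fun s => -f' s)
      (a := 0) (b := t) (B := fun s => ε * (1 + s)) (B' := fun _ => ε) ?_ ?_ ?_ ?_ ?_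
      (right_mem_Icc.2 ht)
    · exact fun s hs => ((hf s hs.1).continuousWithinAt.mono Icc_subset_Ici_self).neg
    · exact fun s hs => (HasDerivWithinAt.mono_Ici (hf s hs.1) hs.1).neg
    · simp only [add_zero, mul_one]; linarith
    · intro s
      simpa using ((hasDerivAt_id s).const_add 1).const_mul ε
    · intro s hs h
      have h1 : 0 < ε * (1 + s) := mul_pos hε (by linarith [hs.1])
      have := hneg s hs.1 (by linarith)
      linarith
  by_contra hlt
  push Not at hlt
  have h1 := key (-f t / (2 * (1 + t))) (by apply div_pos <;> linarith)
  have h2 : -f t / (2 * (1 + t)) * (1 + t) = -f t / 2 := by field_simp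
  linarith

/-! ### Transition densities of the mean-field equation -/

/-- Families of bounded continuous functions of the relative utilization, indexed by an initial
and a final number of bikes. -/
abbrev TransitionFamily (K : ℕ) : Type := Fin (K + 1) → Fin (K + 1) → (ℝ →ᵇ ℝ)

/-- Pointwise truncation of a bounded continuous function to `[0, 1]`. -/
def clampUnit (f : ℝ →ᵇ ℝ) : ℝ →ᵇ ℝ :=
  f.comp (fun x => max 0 (min x 1)) (LipschitzWith.id.min_const 1 |>.const_max 0)

theorem clampUnit_apply (f : ℝ →ᵇ ℝ) (r : ℝ) : clampUnit f r = max 0 (min (f r) 1) := rfl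

theorem norm_clampUnit_le (f : ℝ →ᵇ ℝ) : ‖clampUnit f‖ ≤ 1 := by
  refine (BoundedContinuousFunction.norm_le zero_le_one).2 fun r => ?_
  rw [clampUnit_apply, Real.norm_of_nonneg (le_max_left _ _)]
  exact max_le zero_le_one (min_le_right _ _)

theorem norm_clampUnit_sub_le (f g : ℝ →ᵇ ℝ) : ‖clampUnit f - clampUnit g‖ ≤ ‖f - g‖ := by
  have := (BoundedContinuousFunction.lipschitz_comp (α := ℝ)
    ((LipschitzWith.id (α := ℝ)).min_const 1 |>.const_max 0)).dist_le_mul f g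
  simpa [dist_eq_norm] using! this

theorem clampUnit_of_mem {f : ℝ →ᵇ ℝ} (h : ∀ r, f r ∈ Icc (0 : ℝ) 1) : clampUnit f = f := by
  ext r
  rw [clampUnit_apply, min_eq_left (h r).2, max_eq_right (h r).1]

/-- The forward equation for transition densities, with return rate `α`. -/
def transitionRate {K : ℕ} (C : ℝ) (θ : ℝ →ᵇ ℝ) (α : ℝ) (p : TransitionFamily K) :
    TransitionFamily K :=
  fun j k => ∑ n, (takeCoef k n • (C • (θ * p j n)) + returnCoef k n • (α • p j n))

theorem transitionRate_apply {K : ℕ} (C : ℝ) (θ : ℝ →ᵇ ℝ) (α : ℝ) (p : TransitionFamily K)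
    (j k : Fin (K + 1)) (r : ℝ) : transitionRate C θ α p j k r =
      ∑ n, (takeCoef k n * (C * (θ r * p j n r)) + returnCoef k n * (α * p j n r)) := by
  simp only [transitionRate, BoundedContinuousFunction.coe_sum, Finset.sum_apply]
  rfl

/-- The return rate is kept as a separate variable because it depends on the unknown; with `q = 0`
and `α = β` the estimate also bounds the field itself. -/
theorem norm_transitionRate_sub_le {K : ℕ} {C : ℝ} (hC : 0 ≤ C) {θ : ℝ →ᵇ ℝ} (hθ : ‖θ‖ ≤ 1)
    (α β : ℝ) (p q : TransitionFamily K) :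
    ‖transitionRate C θ α p - transitionRate C θ β q‖ ≤
      (K + 1) * (C * ‖p - q‖ + (|α - β| * ‖p‖ + |β| * ‖p - q‖)) := by
  have hbound : 0 ≤ (K + 1 : ℝ) * (C * ‖p - q‖ + (|α - β| * ‖p‖ + |β| * ‖p - q‖)) := by positivity
  have hcoord : ∀ (s : TransitionFamily K) j n, ‖s j n‖ ≤ ‖s‖ := fun s j n =>
    (norm_le_pi_norm (s j) n).trans (norm_le_pi_norm s j)
  refine (pi_norm_le_iff_of_nonneg hbound).2 fun j => (pi_norm_le_iff_of_nonneg hbound).2 fun k => ?_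
  have h1 : (transitionRate C θ α p - transitionRate C θ β q) j k =
      ∑ n, (takeCoef k n • (C • (θ * (p - q) j n)) +
        returnCoef k n • ((α - β) • p j n + β • (p - q) j n)) := by
    simp only [Pi.sub_apply, transitionRate, ← Finset.sum_sub_distrib]
    refine Finset.sum_congr rfl fun n _ => ?_
    rw [mul_sub]
    module
  rw [h1]
  refine (norm_sum_le _ _).trans ?_
  have h2 : ∀ n, ‖takeCoef k n • (C • (θ * (p - q) j n)) +
      returnCoef k n • ((α - β) • p j n + β • (p - q) j n)‖ ≤
      C * ‖p - q‖ + (|α - β| * ‖p‖ + |β| * ‖p - q‖) := by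
    intro n
    refine (norm_add_le _ _).trans (add_le_add ?_ ?_)
    · rw [norm_smul, norm_smul, Real.norm_eq_abs, Real.norm_of_nonneg hC]
      have h3 : ‖θ * (p - q) j n‖ ≤ ‖p - q‖ :=
        (norm_mul_le _ _).trans ((mul_le_of_le_one_left (norm_nonneg _) hθ).trans (hcoord _ j n))
      calc _ ≤ 1 * (C * ‖p - q‖) := by
            gcongr
            exact abs_takeCoef_le k n
        _ = _ := one_mul _
    · rw [norm_smul, Real.norm_eq_abs]
      calc _ ≤ 1 * (|α - β| * ‖p‖ + |β| * ‖p - q‖) := by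
            gcongr
            · exact abs_returnCoef_le k n
            · refine (norm_add_le _ _).trans ?_
              rw [norm_smul, norm_smul, Real.norm_eq_abs, Real.norm_eq_abs]
              gcongr
              · exact hcoord p j n
              · exact hcoord (p - q) j n
        _ = _ := one_mul _
  refine (Finset.sum_le_sum fun n _ => h2 n).trans_eq ?_
  rw [Finset.sum_const, Finset.card_univ, Fintype.card_fin, nsmul_eq_mul]
  push_cast; rfl

/-- Integration of bounded continuous functions against a finite measure. -/
def integralCLM (μ : Measure ℝ) [IsFiniteMeasure μ] : (ℝ →ᵇ ℝ) →L[ℝ] ℝ :=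
  LinearMap.mkContinuous
    { toFun := fun f => ∫ r, f r ∂μ
      map_add' := fun f g => integral_add (f.integrable μ) (g.integrable μ)
      map_smul' := fun c f => integral_const_mul c f }
    (μ.real univ) fun f => f.norm_integral_le_mul_norm μ

theorem integralCLM_apply (μ : Measure ℝ) [IsFiniteMeasure μ] (f : ℝ →ᵇ ℝ) :
    integralCLM μ f = ∫ r, f r ∂μ := rfl

/-- The average number of bikes per station, for given transition densities. -/
def transitionBikes {K : ℕ} (μ : Fin (K + 1) → Measure ℝ) (p : TransitionFamily K) : ℝ :=
  ∑ n : Fin (K + 1), (n : ℝ) * ∑ j, ∫ r, p j n r ∂(μ j)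

theorem abs_transitionBikes_sub_le {K : ℕ} (μ : Fin (K + 1) → Measure ℝ)
    [∀ k, IsFiniteMeasure (μ k)] (p q : TransitionFamily K) :
    |transitionBikes μ p - transitionBikes μ q| ≤
      (∑ n : Fin (K + 1), (n : ℝ) * ∑ j, (μ j).real univ) * ‖p - q‖ := by
  have hcoord : ∀ j n, ‖(p - q) j n‖ ≤ ‖p - q‖ := fun j n =>
    (norm_le_pi_norm ((p - q) j) n).trans (norm_le_pi_norm (p - q) j)
  unfold transitionBikes
  rw [← Finset.sum_sub_distrib, Finset.sum_mul]
  refine (Finset.abs_sum_le_sum_abs _ _).trans (Finset.sum_le_sum fun n _ => ?_)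
  rw [← mul_sub, abs_mul, abs_of_nonneg (Nat.cast_nonneg _), mul_assoc]
  refine mul_le_mul_of_nonneg_left ?_ (Nat.cast_nonneg _)
  rw [← Finset.sum_sub_distrib, Finset.sum_mul]
  refine (Finset.abs_sum_le_sum_abs _ _).trans (Finset.sum_le_sum fun j _ => ?_)
  rw [← integral_sub ((p j n).integrable _) ((q j n).integrable _)]
  exact ((p j n - q j n).norm_integral_le_mul_norm (μ j)).trans
    (mul_le_mul_of_nonneg_left (hcoord j n) measureReal_nonneg)

/-- The mean-field equation for transition densities has a global solution, made of transition
probabilities. -/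
theorem exists_transition_solution {K : ℕ} {C : ℝ} (hC : 0 ≤ C) {θ : ℝ →ᵇ ℝ}
    (hθ0 : ∀ r, 0 ≤ θ r) (hθ1 : ∀ r, θ r ≤ 1) (γ : ℝ) (μ : Fin (K + 1) → Measure ℝ)
    [∀ k, IsFiniteMeasure (μ k)] (hγ : ∑ n : Fin (K + 1), (n : ℝ) * (μ n).real univ ≤ γ) :
    ∃ p : ℝ → TransitionFamily K,
      (∀ j k r, p 0 j k r = if j = k then 1 else 0) ∧
      (∀ t, 0 ≤ t → HasDerivWithinAt p
        (transitionRate C θ (γ - transitionBikes μ (p t)) (p t)) (Ici 0) t) ∧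
      (∀ t, 0 ≤ t → ∀ j k r, 0 ≤ p t j k r) ∧
      (∀ t, 0 ≤ t → ∀ j r, ∑ k, p t j k r = 1) ∧
      (∀ t, 0 ≤ t → transitionBikes μ (p t) ≤ γ) := by
  have hθ : ‖θ‖ ≤ 1 := (BoundedContinuousFunction.norm_le zero_le_one).2 fun r => by
    rw [Real.norm_of_nonneg (hθ0 r)]; exact hθ1 r
  -- The field is quadratic in `p`. Clamping the densities to `[0, 1]` and the return rate to `[0,
  -- ∞[` makes it bounded and Lipschitz; the solution is then shown to be unaffected by the clamps.
  set ρ : TransitionFamily K → TransitionFamily K := fun p j k => clampUnit (p j k) with hρ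
  set α : TransitionFamily K → ℝ := fun p => max (γ - transitionBikes μ (ρ p)) 0 with hα
  set v : TransitionFamily K → TransitionFamily K := fun p => transitionRate C θ (α p) (ρ p) with hv
  set b : ℝ := ∑ n : Fin (K + 1), (n : ℝ) * ∑ j, (μ j).real univ with hb
  have hb0 : 0 ≤ b := by positivity
  have hρ1 : ∀ p, ‖ρ p‖ ≤ 1 := fun p => (pi_norm_le_iff_of_nonneg zero_le_one).2 fun j =>
    (pi_norm_le_iff_of_nonneg zero_le_one).2 fun k => norm_clampUnit_le _
  have hρL : ∀ p q, ‖ρ p - ρ q‖ ≤ ‖p - q‖ := fun p q =>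
    (pi_norm_le_iff_of_nonneg (norm_nonneg _)).2 fun j =>
      (pi_norm_le_iff_of_nonneg (norm_nonneg _)).2 fun k =>
        (norm_clampUnit_sub_le _ _).trans ((norm_le_pi_norm ((p - q) j) k).trans
          (norm_le_pi_norm (p - q) j))
  have hαL : ∀ p q, |α p - α q| ≤ b * ‖p - q‖ := fun p q => by
    refine (abs_max_sub_max_le_abs _ _ _).trans ?_
    rw [sub_sub_sub_cancel_left, abs_sub_comm]
    exact (abs_transitionBikes_sub_le μ _ _).trans (mul_le_mul_of_nonneg_left (hρL p q) hb0)
  have hα1 : ∀ p, |α p| ≤ |γ| + b := fun p => by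
    have h1 : |transitionBikes μ (ρ p)| ≤ b := by
      have h2 := abs_transitionBikes_sub_le μ (ρ p) (0 : TransitionFamily K)
      have h3 : transitionBikes μ (0 : TransitionFamily K) = 0 := by simp [transitionBikes]
      rw [h3, sub_zero, sub_zero] at h2
      exact h2.trans (mul_le_of_le_one_right hb0 (hρ1 p))
    rw [abs_of_nonneg (le_max_right _ _)]
    refine max_le ?_ (by positivity)
    linarith [le_abs_self γ, neg_le_abs (transitionBikes μ (ρ p))]
  have hvL : ∀ p q, ‖v p - v q‖ ≤ ((K + 1) * (C + (b + (|γ| + b)))) * ‖p - q‖ := fun p q => by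
    refine (norm_transitionRate_sub_le hC hθ _ _ _ _).trans ?_
    rw [show (K + 1) * (C + (b + (|γ| + b))) * ‖p - q‖ = (K + 1 : ℝ) *
      (C * ‖p - q‖ + (b * ‖p - q‖ + (|γ| + b) * ‖p - q‖)) by ring]
    refine mul_le_mul_of_nonneg_left (add_le_add ?_ (add_le_add ?_ ?_)) (by positivity)
    · exact mul_le_mul_of_nonneg_left (hρL p q) hC
    · exact (mul_le_of_le_one_right (abs_nonneg _) (hρ1 p)).trans (hαL p q)
    · exact mul_le_mul (hα1 q) (hρL p q) (norm_nonneg _) (by positivity)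
  have hv1 : ∀ p, ‖v p‖ ≤ (K + 1) * (C + (|γ| + b)) := fun p => by
    have h1 := norm_transitionRate_sub_le hC hθ (α p) (α p) (ρ p) (0 : TransitionFamily K)
    have h2 : transitionRate C θ (α p) (0 : TransitionFamily K) = 0 := by
      ext j k r; simp [transitionRate_apply]
    rw [h2, sub_zero, sub_zero, sub_self, abs_zero, zero_mul, zero_add] at h1
    refine h1.trans (mul_le_mul_of_nonneg_left (add_le_add ?_ ?_) (by positivity))
    · exact mul_le_of_le_one_right hC (hρ1 p)
    · exact (mul_le_of_le_one_right (abs_nonneg _) (hρ1 p)).trans (hα1 p)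
  obtain ⟨p, hp0, hp⟩ := exists_forall_hasDerivWithinAt_Ici (v := v)
    (LipschitzWith.of_dist_le' fun p q => by simpa only [dist_eq_norm] using hvL p q)
    (fun p => (hv1 p).trans (Real.le_coe_toNNReal _)) (fun j k => if j = k then 1 else 0)
  have hp0' : ∀ j k r, p 0 j k r = if j = k then 1 else 0 := fun j k r => by
    rw [hp0]; dsimp only; split_ifs <;> rfl
  have hcoord : ∀ t, 0 ≤ t → ∀ j k,
      HasDerivWithinAt (fun s => p s j k) (v (p t) j k) (Ici 0) t := fun t ht j k =>
    hasDerivWithinAt_pi.1 (hasDerivWithinAt_pi.1 (hp t ht) j) k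
  have hpt : ∀ t, 0 ≤ t → ∀ j k r,
      HasDerivWithinAt (fun s => p s j k r) (v (p t) j k r) (Ici 0) t := fun t ht j k r =>
    (BoundedContinuousFunction.evalCLM ℝ r : (ℝ →ᵇ ℝ) →L[ℝ] ℝ).hasFDerivAt.comp_hasDerivWithinAt t
      (hcoord t ht j k)
  have hρ0 : ∀ t j k r, 0 ≤ ρ (p t) j k r := fun t j k r => le_max_left _ _
  have hα0 : ∀ p, 0 ≤ α p := fun p => le_max_right _ _
  have hnonneg : ∀ t, 0 ≤ t → ∀ j k r, 0 ≤ p t j k r := by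
    intro t ht j k r
    refine nonneg_of_deriv_nonneg_of_neg (f := fun s => p s j k r) ?_
      (fun s hs => hpt s hs j k r) ?_ ht
    · rw [hp0']; split_ifs <;> simp
    · intro s hs hneg
      simp only [hv, transitionRate_apply]
      refine Finset.sum_nonneg fun n _ => ?_
      -- At a negative coordinate the clamped density is `0`, which kills the only term with a
      -- possibly negative coefficient; all inflows are nonnegative.
      by_cases hkn : k = n
      · subst hkn
        have : ρ (p s) j k r = 0 := by
          simp only [hρ, clampUnit_apply]
          exact max_eq_left ((min_le_left _ _).trans hneg.le)
        simp [this]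
      · have h1 := takeCoef_nonneg hkn
        have h2 := returnCoef_nonneg hkn
        have h3 := hρ0 s j n r
        have h4 := hα0 (p s)
        have h5 := hθ0 r
        positivity
  have hsum : ∀ t, 0 ≤ t → ∀ j r, ∑ k, p t j k r = 1 := by
    intro t ht j r
    have hder : ∀ s, 0 ≤ s → HasDerivWithinAt (fun s => ∑ k, p s j k r) 0 (Ici 0) s := by
      intro s hs
      have h1 := HasDerivWithinAt.fun_sum (u := Finset.univ) fun k _ => hpt s hs j k r
      have h2 : ∑ k, v (p s) j k r = 0 := by
        simp only [hv, transitionRate_apply]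
        rw [Finset.sum_comm]
        refine Finset.sum_eq_zero fun n _ => ?_
        rw [Finset.sum_add_distrib, ← Finset.sum_mul, ← Finset.sum_mul, sum_takeCoef,
          sum_returnCoef]
        simp
      rwa [h2] at h1
    have h3 := constant_of_has_deriv_right_zero (f := fun s => ∑ k, p s j k r) (a := 0) (b := t)
      (fun s hs => (hder s hs.1).continuousWithinAt.mono Icc_subset_Ici_self)
      (fun s hs => HasDerivWithinAt.mono_Ici (hder s hs.1) hs.1) t (right_mem_Icc.2 ht)
    simp only [h3, hp0']
    simp
  have hρp : ∀ t, 0 ≤ t → ρ (p t) = p t := by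
    intro t ht
    funext j k
    refine clampUnit_of_mem fun r => ⟨hnonneg t ht j k r, ?_⟩
    rw [← hsum t ht j r]
    exact Finset.single_le_sum (f := fun k => p t j k r) (fun k _ => hnonneg t ht j k r)
      (Finset.mem_univ k)
  -- Were the mean number of bikes to exceed `γ`, the clamped return rate would be `0`, and
  -- departures alone can only lower that mean.
  have hbikes : ∀ t, 0 ≤ t → 0 ≤ γ - transitionBikes μ (p t) := by
    intro t ht
    have hder : ∀ s, 0 ≤ s → HasDerivWithinAt (fun s => γ - transitionBikes μ (p s))
        (-transitionBikes μ (v (p s))) (Ici 0) s := by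
      intro s hs
      refine HasDerivWithinAt.const_sub γ ?_
      refine HasDerivWithinAt.fun_sum fun n _ => HasDerivWithinAt.const_mul (n : ℝ) ?_
      exact HasDerivWithinAt.fun_sum fun j _ =>
        (integralCLM (μ j)).hasFDerivAt.comp_hasDerivWithinAt s (hcoord s hs j n)
    refine nonneg_of_deriv_nonneg_of_neg ?_ hder ?_ ht
    · have h1 : transitionBikes μ (p 0) = ∑ n : Fin (K + 1), (n : ℝ) * (μ n).real univ := by
        simp only [transitionBikes, hp0']
        refine Finset.sum_congr rfl fun n _ => ?_
        rw [Finset.sum_eq_single n]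
        · simp
        · intro j _ hj
          simp [hj]
        · simp
      rw [h1]; linarith
    · intro s hs hneg
      have h1 : α (p s) = 0 := by
        simp only [hα, hρp s hs]
        exact max_eq_right hneg.le
      have h2 : transitionBikes μ (v (p s)) =
          ∑ j, ∫ r, ∑ n : Fin (K + 1), (n : ℝ) * v (p s) j n r ∂(μ j) := by
        simp only [transitionBikes, Finset.mul_sum]
        rw [Finset.sum_comm]
        refine Finset.sum_congr rfl fun j _ => ?_
        rw [integral_finsetSum _ fun n _ => ((v (p s) j n).integrable (μ j)).const_mul _]
        simp only [integral_const_mul]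
      rw [h2, neg_nonneg]
      refine Finset.sum_nonpos fun j _ => integral_nonpos fun r => ?_
      simp only [hv, h1, transitionRate_apply, zero_mul, mul_zero, add_zero, Finset.mul_sum]
      rw [Finset.sum_comm]
      refine Finset.sum_nonpos fun n _ => ?_
      simp only [← mul_assoc, ← Finset.sum_mul]
      rw [sum_mul_takeCoef (fun k => (k : ℝ))]
      have h3 : (if 0 < (n : ℕ) then (((n : ℕ) - 1 : ℕ) : ℝ) - ((n : ℕ) : ℝ) else 0) ≤ 0 := by
        split_ifs
        · rw [sub_nonpos]; exact_mod_cast Nat.sub_le _ _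
        · exact le_rfl
      exact mul_nonpos_of_nonpos_of_nonneg (mul_nonpos_of_nonpos_of_nonneg
        (mul_nonpos_of_nonpos_of_nonneg h3 hC) (hθ0 r)) (hρ0 s j n r)
  refine ⟨p, hp0', fun t ht => ?_, hnonneg, hsum, fun t ht => sub_nonneg.1 (hbikes t ht)⟩
  have h1 : v (p t) = transitionRate C θ (γ - transitionBikes μ (p t)) (p t) := by
    simp only [hv, hα, hρp t ht]
    rw [max_eq_left (hbikes t ht)]
  rw [← h1]
  exact hp t ht

/-! ### The solution of the mean-field equation -/

/-- The bounded continuous function that agrees with `r ↦ c / r` for `r ≥ c`. -/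
def inverseWeight (c : ℝ) (hc : 0 < c) : ℝ →ᵇ ℝ :=
  BoundedContinuousFunction.ofNormedAddCommGroup (fun r => c / max r c)
    (continuous_const.div (continuous_id.max continuous_const)
      fun r => (hc.trans_le (le_max_right r c)).ne') 1 fun r => by
    have h := hc.trans_le (le_max_right r c)
    rw [Real.norm_of_nonneg (by positivity)]
    exact (div_le_one h).2 (le_max_right r c)

theorem inverseWeight_apply {c : ℝ} (hc : 0 < c) (r : ℝ) :
    inverseWeight c hc r = c / max r c := rfl

theorem inverseWeight_nonneg {c : ℝ} (hc : 0 < c) (r : ℝ) : 0 ≤ inverseWeight c hc r :=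
  div_nonneg hc.le (hc.le.trans (le_max_right r c))

theorem inverseWeight_le_one {c : ℝ} (hc : 0 < c) (r : ℝ) : inverseWeight c hc r ≤ 1 :=
  (div_le_one (hc.trans_le (le_max_right r c))).2 (le_max_right r c)

theorem div_eq_mul_inverseWeight {C c : ℝ} (hc : 0 < c) {r : ℝ} (hr : c ≤ r) :
    C * c / r = C * inverseWeight c hc r := by
  rw [inverseWeight_apply, max_eq_left hr, mul_div_assoc]

section Pairing

variable {K : ℕ} (μ : Fin (K + 1) → Measure ℝ)

/-- The `k`-th slice of the measure transported from `μ` by the transition densities `p`. -/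
def transport (p : TransitionFamily K) (k : Fin (K + 1)) : Measure ℝ :=
  ∑ j, (μ j).withDensity fun r => ENNReal.ofReal (p j k r)

/-- The integral of `g` against the `k`-th slice of the transported measure. -/
def pairing (g : ℝ →ᵇ ℝ) (p : TransitionFamily K) (k : Fin (K + 1)) : ℝ :=
  ∑ j, ∫ r, (g * p j k) r ∂(μ j)

/-- The densities act separately at each `r`, so a statement about a set `B` is one about total
masses for the initial measures restricted to `B`. -/
theorem transport_restrict (p : TransitionFamily K) (k : Fin (K + 1)) {B : Set ℝ}
    (hB : MeasurableSet B) :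
    (transport μ p k).restrict B = transport (fun j => (μ j).restrict B) p k := by
  unfold transport
  rw [← Measure.restrictₗ_apply, map_sum]
  refine Finset.sum_congr rfl fun j _ => ?_
  rw [Measure.restrictₗ_apply, restrict_withDensity hB]

variable [∀ j, IsFiniteMeasure (μ j)]

instance isFiniteMeasure_withDensity_boundedContinuous (ν : Measure ℝ) [IsFiniteMeasure ν]
    (f : ℝ →ᵇ ℝ) : IsFiniteMeasure (ν.withDensity fun r => ENNReal.ofReal (f r)) :=
  isFiniteMeasure_withDensity_ofReal (f.integrable ν).2

instance isFiniteMeasure_transport (p : TransitionFamily K) (k : Fin (K + 1)) :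
    IsFiniteMeasure (transport μ p k) := by
  unfold transport; infer_instance

theorem integral_transport {p : TransitionFamily K} (hp : ∀ j k r, 0 ≤ p j k r) (g : ℝ →ᵇ ℝ)
    (k : Fin (K + 1)) : ∫ r, g r ∂(transport μ p k) = pairing μ g p k := by
  unfold transport pairing
  rw [integral_finsetSum_measure fun j _ => g.integrable _]
  refine Finset.sum_congr rfl fun j _ => ?_
  rw [integral_withDensity_eq_integral_toReal_smul
    (p j k).continuous.measurable.ennreal_ofReal
    (ae_of_all _ fun _ => ENNReal.ofReal_lt_top)]
  refine integral_congr_ae (ae_of_all _ fun r => ?_)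
  simp [ENNReal.toReal_ofReal (hp j k r), mul_comm]

theorem real_transport {p : TransitionFamily K} (hp : ∀ j k r, 0 ≤ p j k r)
    (k : Fin (K + 1)) {B : Set ℝ} (hB : MeasurableSet B) :
    (transport μ p k).real B = pairing (fun j => (μ j).restrict B) 1 p k := by
  rw [← integral_transport _ hp, ← transport_restrict μ p k hB]
  simp

/-- The pairing is continuous and linear in `p`. Taking `g = θ ^ a` gives the moment hierarchy, and
`g = 1` with restricted measures gives the setwise equation. -/
theorem hasDerivWithinAt_pairing {C α : ℝ} {θ : ℝ →ᵇ ℝ} {p : ℝ → TransitionFamily K} {t : ℝ}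
    (hp : HasDerivWithinAt p (transitionRate C θ α (p t)) (Ici 0) t) (g : ℝ →ᵇ ℝ)
    (k : Fin (K + 1)) :
    HasDerivWithinAt (fun s => pairing μ g (p s) k)
      (∑ n, (takeCoef k n * (C * pairing μ (g * θ) (p t) n) +
        returnCoef k n * (α * pairing μ g (p t) n))) (Ici 0) t := by
  have hcoord : ∀ j, HasDerivWithinAt (fun s => p s j k) (transitionRate C θ α (p t) j k)
      (Ici 0) t := fun j => hasDerivWithinAt_pi.1 (hasDerivWithinAt_pi.1 hp j) k
  have h1 : ∀ j, HasDerivWithinAt (fun s => ∫ r, (g * p s j k) r ∂(μ j))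
      (∑ n, (takeCoef k n * (C * ∫ r, (g * θ * p t j n) r ∂(μ j)) +
        returnCoef k n * (α * ∫ r, (g * p t j n) r ∂(μ j)))) (Ici 0) t := by
    intro j
    have h2 := (((integralCLM (μ j)).comp
      (ContinuousLinearMap.mul ℝ (ℝ →ᵇ ℝ) g)).hasFDerivAt.comp_hasDerivWithinAt t (hcoord j))
    have h3 : ((integralCLM (μ j)).comp (ContinuousLinearMap.mul ℝ (ℝ →ᵇ ℝ) g))
        (transitionRate C θ α (p t) j k) =
        ∑ n, (takeCoef k n * (C * ∫ r, (g * θ * p t j n) r ∂(μ j)) +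
          returnCoef k n * (α * ∫ r, (g * p t j n) r ∂(μ j))) := by
      simp only [transitionRate, map_sum, map_add, map_smul, smul_eq_mul]
      refine Finset.sum_congr rfl fun n _ => ?_
      simp only [ContinuousLinearMap.comp_apply, ContinuousLinearMap.mul_apply',
        integralCLM_apply, mul_assoc]
    rw [h3] at h2
    exact h2
  have h4 := HasDerivWithinAt.fun_sum (u := Finset.univ) fun j _ => h1 j
  refine h4.congr_deriv ?_
  rw [Finset.sum_comm]
  simp only [Finset.sum_add_distrib, ← Finset.mul_sum]
  rfl

end Pairing

theorem transport_initial {K : ℕ} (μ : Fin (K + 1) → Measure ℝ) {p : TransitionFamily K}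
    (hp : ∀ j k r, p j k r = if j = k then 1 else 0) : transport μ p = μ := by
  funext k
  unfold transport
  rw [Finset.sum_eq_single k]
  · simp [hp]
  · intro j _ hj
    simp [hp, hj]
  · simp

theorem transport_null {K : ℕ} {μ : Fin (K + 1) → Measure ℝ} {A : Set ℝ}
    (hA : ∀ j, μ j A = 0) (p : TransitionFamily K) (k : Fin (K + 1)) : transport μ p k A = 0 := by
  unfold transport
  rw [Measure.finsetSum_apply]
  exact Finset.sum_eq_zero fun j _ => withDensity_absolutelyContinuous _ _ (hA j)

theorem ae_le_of_measure_compl_Icc {ν : Measure ℝ} {c : ℝ} (h : ν (Icc c 1)ᶜ = 0) :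
    ∀ᵐ r ∂ν, c ≤ r := by
  refine measure_mono_null (fun r hr => ?_) h
  exact fun h2 => hr h2.1

theorem integrable_div_of_measure_compl_Icc {ν : Measure ℝ} [IsFiniteMeasure ν] {C c : ℝ}
    (hc : 0 < c) (h : ν (Icc c 1)ᶜ = 0) : Integrable (fun r => C * c / r) ν := by
  refine (((inverseWeight c hc).integrable ν).const_mul C).congr ?_
  filter_upwards [ae_le_of_measure_compl_Icc h] with r hr
  exact (div_eq_mul_inverseWeight hc hr).symm

theorem setIntegral_div_of_measure_compl_Icc {ν : Measure ℝ} {C c : ℝ} (hc : 0 < c)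
    (h : ν (Icc c 1)ᶜ = 0) (B : Set ℝ) :
    ∫ r in B, C * c / r ∂ν = C * ∫ r in B, inverseWeight c hc r ∂ν := by
  rw [← integral_const_mul]
  refine integral_congr_ae (ae_restrict_of_ae ?_)
  filter_upwards [ae_le_of_measure_compl_Icc h] with r hr
  exact div_eq_mul_inverseWeight hc hr

theorem meanBikes_transport {K : ℕ} (μ : Fin (K + 1) → Measure ℝ) [∀ j, IsFiniteMeasure (μ j)]
    {p : TransitionFamily K} (hp : ∀ j k r, 0 ≤ p j k r) :
    meanBikes (transport μ p) = transitionBikes μ p := by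
  unfold meanBikes transitionBikes
  refine Finset.sum_congr rfl fun n _ => ?_
  rw [real_transport μ hp n MeasurableSet.univ]
  simp [pairing]

theorem isMeanFieldSolution_transport {K : ℕ} {C c γ : ℝ} (hc : 0 < c)
    {μ : Fin (K + 1) → Measure ℝ} [∀ j, IsFiniteMeasure (μ j)] (hμ : ∀ j, μ j (Icc c 1)ᶜ = 0)
    {p : ℝ → TransitionFamily K} (hp0 : ∀ j k r, p 0 j k r = if j = k then 1 else 0)
    (hp : ∀ t, 0 ≤ t → HasDerivWithinAt p
      (transitionRate C (inverseWeight c hc) (γ - transitionBikes μ (p t)) (p t)) (Ici 0) t)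
    (hpn : ∀ t, 0 ≤ t → ∀ j k r, 0 ≤ p t j k r) :
    IsMeanFieldSolution (C * c) γ μ fun t => transport μ (p t) where
  initial := transport_initial μ hp0
  finite t _ k := inferInstance
  support t _ k := by
    have hsub : Icc c 1 ⊆ Ioc 0 1 := fun r hr => ⟨hc.trans_le hr.1, hr.2⟩
    exact transport_null (fun j => measure_mono_null (compl_subset_compl.2 hsub) (hμ j)) _ _
  integrable t _ k := integrable_div_of_measure_compl_Icc hc (transport_null hμ _ _)
  hasDeriv t ht k B hB := by
    have h1 := hasDerivWithinAt_pairing (fun j => (μ j).restrict B) (hp t ht) 1 k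
    have h2 : HasDerivWithinAt (fun s => (transport μ (p s) k).real B) _ (Ici 0) t :=
      h1.congr (fun s hs => real_transport μ (hpn s hs) k hB) (real_transport μ (hpn t ht) k hB)
    refine h2.congr_deriv ?_
    rw [drift_eq]
    refine Finset.sum_congr rfl fun n _ => ?_
    rw [setIntegral_div_of_measure_compl_Icc hc (transport_null hμ _ _), one_mul,
      meanBikes_transport μ (hpn t ht), real_transport μ (hpn t ht) n hB,
      transport_restrict μ (p t) n hB, integral_transport _ (hpn t ht)]

/-! ### Uniqueness for the mean-field equation -/

/-- By the layer cake formula the integral averages the masses of `{g ≥ s} ∩ B` over `s` in `]0,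
1]`, and these differ by at most `ε`. No total variation constant is lost. -/
theorem abs_setIntegral_sub_le {μ ν : Measure ℝ} [IsFiniteMeasure μ] [IsFiniteMeasure ν]
    {g : ℝ → ℝ} (hg : Measurable g) (hg0 : ∀ r, 0 ≤ g r) (hg1 : ∀ r, g r ≤ 1) {ε : ℝ}
    (h : ∀ A, MeasurableSet A → |μ.real A - ν.real A| ≤ ε) {B : Set ℝ} (hB : MeasurableSet B) :
    |∫ r in B, g r ∂μ - ∫ r in B, g r ∂ν| ≤ ε := by
  have hlayer : ∀ (ρ : Measure ℝ) [IsFiniteMeasure ρ], ∫ r in B, g r ∂ρ =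
      ∫ s in Ioc (0 : ℝ) 1, ρ.real ({r | s ≤ g r} ∩ B) := by
    intro ρ _
    have hint : Integrable g (ρ.restrict B) :=
      Integrable.of_bound hg.aestronglyMeasurable 1 (ae_of_all _ fun r => by
        rw [Real.norm_of_nonneg (hg0 r)]; exact hg1 r)
    rw [hint.integral_eq_integral_Ioc_meas_le (M := 1) (ae_of_all _ hg0) (ae_of_all _ hg1)]
    refine integral_congr_ae (ae_of_all _ fun s => ?_)
    exact measureReal_restrict_apply (measurableSet_le measurable_const hg)
  have hint : ∀ (ρ : Measure ℝ) [IsFiniteMeasure ρ],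
      IntegrableOn (fun s => ρ.real ({r | s ≤ g r} ∩ B)) (Ioc (0 : ℝ) 1) := by
    intro ρ _
    refine AntitoneOn.integrableOn_isCompact (s := Icc (0 : ℝ) 1) isCompact_Icc ?_ |>.mono_set
      Ioc_subset_Icc_self
    intro s _ s' _ hss
    exact measureReal_mono (inter_subset_inter_left _ fun r hr => hss.trans hr)
  rw [hlayer μ, hlayer ν, ← integral_sub (hint μ) (hint ν)]
  have h1 := norm_setIntegral_le_of_norm_le_const (μ := volume) (s := Ioc (0 : ℝ) 1)
    (f := fun s => μ.real ({r | s ≤ g r} ∩ B) - ν.real ({r | s ≤ g r} ∩ B)) (C := ε)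
    (by simp) fun s _ => h _ ((measurableSet_le measurable_const hg).inter hB)
  simpa using h1

section Uniqueness

variable {K : ℕ} {C c γ : ℝ} {μ : Fin (K + 1) → Measure ℝ}
  {z w : ℝ → Fin (K + 1) → Measure ℝ}

theorem sum_drift (Λ γ : ℝ) (y : Fin (K + 1) → Measure ℝ) (B : Set ℝ) :
    ∑ k, drift Λ γ y B k = 0 := by
  simp only [drift_eq]
  rw [Finset.sum_comm]
  refine Finset.sum_eq_zero fun n _ => ?_
  rw [Finset.sum_add_distrib, ← Finset.sum_mul, ← Finset.sum_mul, sum_takeCoef, sum_returnCoef]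
  simp

/-- Stations change their content, never their utilization: the marginal in `r` is conserved. -/
theorem IsMeanFieldSolution.sum_real_eq {Λ : ℝ} (hz : IsMeanFieldSolution Λ γ μ z) {t : ℝ}
    (ht : 0 ≤ t) {B : Set ℝ} (hB : MeasurableSet B) :
    ∑ k, (z t k).real B = ∑ k, (μ k).real B := by
  have hder : ∀ s, 0 ≤ s → HasDerivWithinAt (fun s => ∑ k, (z s k).real B) 0 (Ici 0) s := by
    intro s hs
    have h1 := HasDerivWithinAt.fun_sum (u := Finset.univ) fun k _ => hz.hasDeriv s hs k B hB
    rwa [sum_drift] at h1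
  have h3 := constant_of_has_deriv_right_zero (f := fun s => ∑ k, (z s k).real B) (a := 0) (b := t)
    (fun s hs => (hder s hs.1).continuousWithinAt.mono Icc_subset_Ici_self)
    (fun s hs => HasDerivWithinAt.mono_Ici (hder s hs.1) hs.1) t (right_mem_Icc.2 ht)
  simpa [hz.initial] using h3

/-- Conservation of the `r`-marginal keeps an arbitrary solution away from `r = 0`; on `[c, 1]` the
rate `Λ / r` is bounded. -/
theorem IsMeanFieldSolution.measure_compl_Icc {Λ : ℝ} (hz : IsMeanFieldSolution Λ γ μ z)
    (hμ : ∀ j, μ j (Icc c 1)ᶜ = 0) {t : ℝ} (ht : 0 ≤ t) (k : Fin (K + 1)) :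
    z t k (Icc c 1)ᶜ = 0 := by
  have h1 := hz.sum_real_eq ht (measurableSet_Icc (a := c) (b := 1)).compl
  have h2 : ∑ k, (μ k).real (Icc c 1)ᶜ = 0 := Finset.sum_eq_zero fun j _ => by
    simp [measureReal_def, hμ j]
  rw [h2, Finset.sum_eq_zero_iff_of_nonneg fun _ _ => measureReal_nonneg] at h1
  have := hz.finite t ht k
  exact (measureReal_eq_zero_iff).1 (h1 k (Finset.mem_univ k))

theorem IsMeanFieldSolution.real_le_one {Λ : ℝ} (hz : IsMeanFieldSolution Λ γ μ z)
    (hmass : ∑ j, (μ j).real univ = 1) {t : ℝ} (ht : 0 ≤ t) (k : Fin (K + 1)) (B : Set ℝ) :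
    (z t k).real B ≤ 1 := by
  have := hz.finite t ht
  calc (z t k).real B ≤ (z t k).real univ := measureReal_mono (subset_univ _)
    _ ≤ ∑ k, (z t k).real univ := Finset.single_le_sum
        (f := fun k => (z t k).real univ) (fun _ _ => measureReal_nonneg) (Finset.mem_univ k)
    _ = 1 := by rw [hz.sum_real_eq ht MeasurableSet.univ, hmass]

theorem abs_drift_sub_le (hC : 0 ≤ C) (hc : 0 < c) {y y' : Fin (K + 1) → Measure ℝ}
    [∀ k, IsFiniteMeasure (y k)] [∀ k, IsFiniteMeasure (y' k)]
    (hy : ∀ k, y k (Icc c 1)ᶜ = 0) (hy' : ∀ k, y' k (Icc c 1)ᶜ = 0)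
    (hy1 : ∀ k B, (y k).real B ≤ 1) (hy1' : ∀ k B, (y' k).real B ≤ 1) {ε : ℝ}
    (h : ∀ k B, MeasurableSet B → |(y k).real B - (y' k).real B| ≤ ε) {B : Set ℝ}
    (hB : MeasurableSet B) (k : Fin (K + 1)) :
    |drift (C * c) γ y B k - drift (C * c) γ y' B k| ≤
      (K + 1) * (C + (|γ| + 2 * ∑ n : Fin (K + 1), (n : ℝ))) * ε := by
  set b : ℝ := ∑ n : Fin (K + 1), (n : ℝ) with hb
  have hb0 : 0 ≤ b := by positivity
  have hm : |meanBikes y| ≤ b := by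
    refine (Finset.abs_sum_le_sum_abs _ _).trans (Finset.sum_le_sum fun n _ => ?_)
    rw [abs_of_nonneg (mul_nonneg (Nat.cast_nonneg _) measureReal_nonneg)]
    exact mul_le_of_le_one_right (Nat.cast_nonneg _) (hy1 n _)
  have hmm : |meanBikes y - meanBikes y'| ≤ b * ε := by
    unfold meanBikes
    rw [← Finset.sum_sub_distrib, hb, Finset.sum_mul]
    refine (Finset.abs_sum_le_sum_abs _ _).trans (Finset.sum_le_sum fun n _ => ?_)
    rw [← mul_sub, abs_mul, abs_of_nonneg (Nat.cast_nonneg _)]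
    exact mul_le_mul_of_nonneg_left (h n _ MeasurableSet.univ) (Nat.cast_nonneg _)
  have hterm : ∀ n, |takeCoef k n * (∫ r in B, C * c / r ∂(y n) - ∫ r in B, C * c / r ∂(y' n)) +
      returnCoef k n * ((γ - meanBikes y) * (y n).real B - (γ - meanBikes y') * (y' n).real B)| ≤
      (C + (|γ| + 2 * b)) * ε := by
    intro n
    have h1 : |∫ r in B, C * c / r ∂(y n) - ∫ r in B, C * c / r ∂(y' n)| ≤ C * ε := by
      rw [setIntegral_div_of_measure_compl_Icc hc (hy n),
        setIntegral_div_of_measure_compl_Icc hc (hy' n), ← mul_sub, abs_mul, abs_of_nonneg hC]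
      exact mul_le_mul_of_nonneg_left (abs_setIntegral_sub_le
        (inverseWeight c hc).continuous.measurable (inverseWeight_nonneg hc)
        (inverseWeight_le_one hc) (h n) hB) hC
    have h2 : |(γ - meanBikes y) * (y n).real B - (γ - meanBikes y') * (y' n).real B| ≤
        (|γ| + 2 * b) * ε := by
      have h3 : (γ - meanBikes y) * (y n).real B - (γ - meanBikes y') * (y' n).real B =
          (γ - meanBikes y) * ((y n).real B - (y' n).real B) +
            (meanBikes y' - meanBikes y) * (y' n).real B := by ring
      rw [h3]
      refine (abs_add_le _ _).trans ?_
      rw [abs_mul, abs_mul, abs_sub_comm (meanBikes y'),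
        abs_of_nonneg (measureReal_nonneg (μ := y' n))]
      have h4 : |γ - meanBikes y| * |(y n).real B - (y' n).real B| ≤ (|γ| + b) * ε :=
        mul_le_mul ((abs_sub _ _).trans (add_le_add le_rfl hm)) (h n B hB) (abs_nonneg _)
          (by positivity)
      have h5 : |meanBikes y - meanBikes y'| * (y' n).real B ≤ b * ε :=
        (mul_le_of_le_one_right (abs_nonneg _) (hy1' n B)).trans hmm
      linarith
    refine (abs_add_le _ _).trans ?_
    rw [abs_mul, abs_mul]
    have h6 := mul_le_of_le_one_left (abs_nonneg (∫ r in B, C * c / r ∂(y n) -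
      ∫ r in B, C * c / r ∂(y' n))) (abs_takeCoef_le k n)
    have h7 := mul_le_of_le_one_left (abs_nonneg ((γ - meanBikes y) * (y n).real B -
      (γ - meanBikes y') * (y' n).real B)) (abs_returnCoef_le k n)
    linarith
  rw [drift_eq, drift_eq, ← Finset.sum_sub_distrib]
  refine (Finset.abs_sum_le_sum_abs _ _).trans ?_
  calc _ ≤ ∑ _n : Fin (K + 1), (C + (|γ| + 2 * b)) * ε := Finset.sum_le_sum fun n _ => by
        refine le_of_eq_of_le ?_ (hterm n)
        congr 1; ring
    _ = _ := by
        rw [Finset.sum_const, Finset.card_univ, Fintype.card_fin, nsmul_eq_mul]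
        push_cast; ring

/-- Picard iteration: a bound uniform over sets is fed into the drift and integrated for one set at
a time, so the supremum over sets is never differentiated in time. The bounds `(L * t) ^ m / m!`
tend to `0`. -/
theorem IsMeanFieldSolution.eq (hC : 0 ≤ C) (hc : 0 < c) (hμ : ∀ j, μ j (Icc c 1)ᶜ = 0)
    (hmass : ∑ j, (μ j).real univ = 1) (hz : IsMeanFieldSolution (C * c) γ μ z)
    (hw : IsMeanFieldSolution (C * c) γ μ w) {t : ℝ} (ht : 0 ≤ t) : z t = w t := by
  set L : ℝ := (K + 1) * (C + (|γ| + 2 * ∑ n : Fin (K + 1), (n : ℝ))) with hL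
  have key : ∀ m : ℕ, ∀ s, 0 ≤ s → ∀ k B, MeasurableSet B →
      |(z s k).real B - (w s k).real B| ≤ (L * s) ^ m / m.factorial := by
    intro m
    induction m with
    | zero =>
      intro s hs k B _
      simp only [pow_zero, Nat.factorial_zero, Nat.cast_one, div_one]
      refine abs_sub_le_iff.2 ⟨?_, ?_⟩
      · linarith [hz.real_le_one hmass hs k B, measureReal_nonneg (μ := w s k) (s := B)]
      · linarith [hw.real_le_one hmass hs k B, measureReal_nonneg (μ := z s k) (s := B)]
    | succ m ih =>
      intro s hs k B hB
      have hder : ∀ u, 0 ≤ u → HasDerivWithinAt (fun u => (z u k).real B - (w u k).real B)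
          (drift (C * c) γ (z u) B k - drift (C * c) γ (w u) B k) (Ici 0) u := fun u hu =>
        (hz.hasDeriv u hu k B hB).sub (hw.hasDeriv u hu k B hB)
      refine image_norm_le_of_norm_deriv_right_le_deriv_boundary (E := ℝ)
        (f := fun u => (z u k).real B - (w u k).real B) (a := 0) (b := s)
        (B := fun u => (L * u) ^ (m + 1) / (m + 1).factorial)
        (B' := fun u => L * ((L * u) ^ m / m.factorial))
        (fun u hu => (hder u hu.1).continuousWithinAt.mono Icc_subset_Ici_self)
        (fun u hu => HasDerivWithinAt.mono_Ici (hder u hu.1) hu.1) ?_ ?_ ?_ (right_mem_Icc.2 hs)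
      · simp [hz.initial, hw.initial]
      · intro u
        have h1 := ((((hasDerivAt_id u).const_mul L).pow (m + 1)).div_const
          ((m + 1).factorial : ℝ))
        refine h1.congr_deriv ?_
        rw [Nat.factorial_succ]
        push_cast
        have h2 : (m.factorial : ℝ) ≠ 0 := by positivity
        simp only [id]
        field_simp
      · intro u hu
        have := hz.finite u hu.1
        have := hw.finite u hu.1
        exact abs_drift_sub_le hC hc (hz.measure_compl_Icc hμ hu.1) (hw.measure_compl_Icc hμ hu.1)
          (hz.real_le_one hmass hu.1) (hw.real_le_one hmass hu.1) (ih u hu.1) hB k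
  funext k
  have := hz.finite t ht k
  have := hw.finite t ht k
  refine Measure.ext fun B hB => ?_
  have h1 : |(z t k).real B - (w t k).real B| ≤ 0 :=
    ge_of_tendsto' (FloorSemiring.tendsto_pow_div_factorial_atTop (L * t))
      fun m => key m t ht k B hB
  have h2 : (z t k).real B = (w t k).real B := by
    have := abs_nonpos_iff.1 h1; linarith
  exact (measureReal_eq_measureReal_iff).1 h2

end Uniqueness

/-! ### Deterministic comparison of the moments with their limits on a grid -/

/-- The drift of the moments `z a k = ∫ θ ^ a y(dr, k)` under the mean-field equation. -/
def momentDrift {K : ℕ} (C γ : ℝ) (z : ℕ → Fin (K + 1) → ℝ) (a : ℕ) (k : Fin (K + 1)) : ℝ :=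
  ∑ n, (takeCoef k n * (C * z (a + 1) n) +
    returnCoef k n * ((γ - ∑ l : Fin (K + 1), (l : ℝ) * z 0 l) * z a n))

/-- The distance between the moments of order `a` of a state and given values. -/
def momentDist {K N : ℕ} (θ : Fin N → ℝ) (x : State K N) (z : ℕ → Fin (K + 1) → ℝ) (a : ℕ) : ℝ :=
  ∑ k, |moment θ a k x - z a k|

theorem momentDist_nonneg {K N : ℕ} (θ : Fin N → ℝ) (x : State K N)
    (z : ℕ → Fin (K + 1) → ℝ) (a : ℕ) : 0 ≤ momentDist θ x z a :=
  Finset.sum_nonneg fun _ _ => abs_nonneg _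

theorem momentDist_le {K N : ℕ} {θ : Fin N → ℝ} (hθ0 : ∀ i, 0 ≤ θ i) (hθ1 : ∀ i, θ i ≤ 1)
    (x : State K N) {z : ℕ → Fin (K + 1) → ℝ} (hz0 : ∀ a k, 0 ≤ z a k) (hz1 : ∀ a k, z a k ≤ 1)
    (a : ℕ) : momentDist θ x z a ≤ K + 1 := by
  refine (Finset.sum_le_sum (g := fun _ => (1 : ℝ)) fun k _ => abs_sub_le_iff.2 ⟨?_, ?_⟩).trans ?_
  · linarith [moment_le_one hθ0 hθ1 a k x, hz0 a k]
  · linarith [moment_nonneg hθ0 a k x, hz1 a k]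
  · simp

theorem abs_generator_moment_sub_le {K N : ℕ} (M : ℕ) {lam θ : Fin N → ℝ} {c C γ : ℝ}
    (hC : 0 ≤ C) (hlam : ∀ i, lam i = c * θ i) (hθ0 : ∀ i, 0 ≤ θ i) (hθ1 : ∀ i, θ i ≤ 1)
    (x : State K N) {z : ℕ → Fin (K + 1) → ℝ} (hz0 : ∀ a k, 0 ≤ z a k)
    (hz : ∑ l : Fin (K + 1), (l : ℝ) * z 0 l ≤ γ) (a : ℕ) (k : Fin (K + 1)) :
    |∑ y, jumpRate M lam x y * (moment θ a k y - moment θ a k x) - momentDrift C γ z a k| ≤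
      (K + 1) * (|c - C| + |(M : ℝ) / N - γ|) + (C + |γ| + (K + 1) * K) *
        (momentDist θ x z (a + 1) + momentDist θ x z a + momentDist θ x z 0) := by
  rw [sum_jumpRate_moment M hlam, return_rate_eq M θ x]
  unfold momentDrift
  set α : ℝ := γ - ∑ l : Fin (K + 1), (l : ℝ) * z 0 l with hα
  set α' : ℝ := max ((M : ℝ) / N - ∑ n : Fin (K + 1), (n : ℝ) * moment θ 0 n x) 0 with hα'
  have hα0 : 0 ≤ α := sub_nonneg.2 hz
  have hαγ : α ≤ |γ| := by
    have : 0 ≤ ∑ l : Fin (K + 1), (l : ℝ) * z 0 l :=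
      Finset.sum_nonneg fun l _ => mul_nonneg (Nat.cast_nonneg _) (hz0 0 l)
    linarith [le_abs_self γ]
  have hαα : |α' - α| ≤ |(M : ℝ) / N - γ| + K * momentDist θ x z 0 := by
    -- The positive part is `1`-Lipschitz and fixes `α`, which is nonnegative by `hz`.
    have h1 : |α' - α| ≤ |((M : ℝ) / N - ∑ n : Fin (K + 1), (n : ℝ) * moment θ 0 n x) - α| := by
      have := abs_max_sub_max_le_abs
        ((M : ℝ) / N - ∑ n : Fin (K + 1), (n : ℝ) * moment θ 0 n x) α 0
      rwa [max_eq_left hα0] at this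
    have h2 : ((M : ℝ) / N - ∑ n : Fin (K + 1), (n : ℝ) * moment θ 0 n x) - α =
        ((M : ℝ) / N - γ) - ∑ n : Fin (K + 1), (n : ℝ) * (moment θ 0 n x - z 0 n) := by
      simp only [mul_sub, Finset.sum_sub_distrib, hα]; ring
    rw [h2] at h1
    refine h1.trans ((abs_sub _ _).trans (add_le_add le_rfl ?_))
    unfold momentDist
    rw [Finset.mul_sum]
    refine (Finset.abs_sum_le_sum_abs _ _).trans (Finset.sum_le_sum fun n _ => ?_)
    rw [abs_mul, abs_of_nonneg (Nat.cast_nonneg _)]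
    refine mul_le_mul_of_nonneg_right ?_ (abs_nonneg _)
    exact_mod_cast Nat.lt_succ_iff.1 n.2
  have hterm : ∀ n, |(takeCoef k n * (c * moment θ (a + 1) n x) +
      returnCoef k n * (α' * moment θ a n x)) - (takeCoef k n * (C * z (a + 1) n) +
      returnCoef k n * (α * z a n))| ≤ (|c - C| + C * |moment θ (a + 1) n x - z (a + 1) n|) +
        (|α' - α| + |γ| * |moment θ a n x - z a n|) := by
    intro n
    have hbd : ∀ b, |moment θ b n x| ≤ 1 := fun b => by
      rw [abs_of_nonneg (moment_nonneg hθ0 b n x)]; exact moment_le_one hθ0 hθ1 b n x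
    have h1 : (takeCoef k n * (c * moment θ (a + 1) n x) +
        returnCoef k n * (α' * moment θ a n x)) - (takeCoef k n * (C * z (a + 1) n) +
        returnCoef k n * (α * z a n)) =
        takeCoef k n * ((c - C) * moment θ (a + 1) n x +
          C * (moment θ (a + 1) n x - z (a + 1) n)) +
        returnCoef k n * ((α' - α) * moment θ a n x + α * (moment θ a n x - z a n)) := by ring
    rw [h1]
    refine (abs_add_le _ _).trans (add_le_add ?_ ?_)
    · rw [abs_mul]
      refine (mul_le_of_le_one_left (abs_nonneg _) (abs_takeCoef_le k n)).trans
        ((abs_add_le _ _).trans (add_le_add ?_ ?_))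
      · rw [abs_mul]; exact mul_le_of_le_one_right (abs_nonneg _) (hbd _)
      · rw [abs_mul, abs_of_nonneg hC]
    · rw [abs_mul]
      refine (mul_le_of_le_one_left (abs_nonneg _) (abs_returnCoef_le k n)).trans
        ((abs_add_le _ _).trans (add_le_add ?_ ?_))
      · rw [abs_mul]; exact mul_le_of_le_one_right (abs_nonneg _) (hbd _)
      · rw [abs_mul, abs_of_nonneg hα0]
        exact mul_le_mul_of_nonneg_right hαγ (abs_nonneg _)
  rw [← Finset.sum_sub_distrib]
  refine (Finset.abs_sum_le_sum_abs _ _).trans ((Finset.sum_le_sum fun n _ => hterm n).trans ?_)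
  have h3 : ∑ n : Fin (K + 1), ((|c - C| + C * |moment θ (a + 1) n x - z (a + 1) n|) +
      (|α' - α| + |γ| * |moment θ a n x - z a n|)) =
      (K + 1) * |c - C| + C * momentDist θ x z (a + 1) +
        ((K + 1) * |α' - α| + |γ| * momentDist θ x z a) := by
    simp only [Finset.sum_add_distrib, ← Finset.mul_sum, Finset.sum_const, Finset.card_univ,
      Fintype.card_fin, nsmul_eq_mul, momentDist]
    push_cast; rfl
  rw [h3]
  have h4 := mul_le_mul_of_nonneg_left hαα (by positivity : (0 : ℝ) ≤ K + 1)
  have d0 := momentDist_nonneg θ x z 0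
  have d1 := momentDist_nonneg θ x z a
  have d2 := momentDist_nonneg θ x z (a + 1)
  have hK : (0 : ℝ) ≤ (K + 1) * K := by positivity
  nlinarith [mul_nonneg hC d0, mul_nonneg hC d1, mul_nonneg (abs_nonneg γ) d0,
    mul_nonneg (abs_nonneg γ) d2, mul_nonneg hK d1, mul_nonneg hK d2]

/-- Riemann sums of the derivative. -/
theorem eventually_abs_sub_riemann_le {F F' : ℝ → ℝ} {T : ℝ}
    (hF : ∀ t, 0 ≤ t → HasDerivWithinAt F (F' t) (Ici 0) t) (hF' : ContinuousOn F' (Icc 0 T))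
    {η : ℝ} (hη : 0 < η) :
    ∀ᶠ h : ℝ in 𝓝[>] 0, ∀ n : ℕ, n * h ≤ T → ∀ j ≤ n,
      |F (j * h) - F 0 - h * ∑ i ∈ Finset.range j, F' (i * h)| ≤ j * h * η := by
  obtain ⟨r, hr, hunif⟩ := Metric.uniformContinuousOn_iff.1
    (isCompact_Icc.uniformContinuousOn_of_continuous hF') η hη
  filter_upwards [Ioo_mem_nhdsGT hr] with h hh n hn j hj
  have hh0 : 0 < h := hh.1
  have hstep : ∀ i : ℕ, i + 1 ≤ n →
      |F ((i + 1 : ℕ) * h) - F (i * h) - h * F' (i * h)| ≤ h * η := by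
    intro i hi
    have hi' : ((i + 1 : ℕ) : ℝ) * h ≤ T :=
      (mul_le_mul_of_nonneg_right (by exact_mod_cast hi) hh0.le).trans hn
    have hs0 : (0 : ℝ) ≤ i * h := by positivity
    have hnext : ((i + 1 : ℕ) : ℝ) * h = i * h + h := by push_cast; ring
    -- Mean value inequality after subtracting the linear part `F' (i * h) * u`: the remaining slope
    -- is below `η` by uniform continuity.
    have h1 := norm_image_sub_le_of_norm_deriv_right_le_segment (E := ℝ)
      (f := fun u => F u - F' (i * h) * u) (f' := fun u => F' u - F' (i * h)) (C := η)
      (a := i * h) (b := i * h + h)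
      (fun u hu => ((hF u (hs0.trans hu.1)).continuousWithinAt.mono
        (fun v hv => hs0.trans hv.1)).sub (continuous_const.mul continuous_id).continuousWithinAt)
      (fun u hu => by
        have h2 := (HasDerivWithinAt.mono_Ici (hF u (hs0.trans hu.1)) (hs0.trans hu.1)).sub
          ((hasDerivWithinAt_id u (Ici u)).const_mul (F' (i * h)))
        simpa using! h2)
      (fun u hu => by
        have := hunif u ⟨hs0.trans hu.1, by linarith [hu.2]⟩ (i * h)
          ⟨hs0, by linarith⟩ (by
            rw [Real.dist_eq, abs_of_nonneg (by linarith [hu.1])]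
            linarith [hu.2, hh.2])
        rw [Real.dist_eq] at this
        exact this.le) (i * h + h) ⟨by linarith, le_rfl⟩
    rw [hnext]
    have h3 : F (i * h + h) - F (i * h) - h * F' (i * h) =
        (F (i * h + h) - F' (i * h) * (i * h + h)) - (F (i * h) - F' (i * h) * (i * h)) := by ring
    rw [h3]
    calc _ ≤ η * (i * h + h - i * h) := h1
      _ = h * η := by ring
  induction j with
  | zero => simp
  | succ j ih =>
    have h4 := ih (by omega)
    have h5 := hstep j hj
    rw [Finset.sum_range_succ]
    have h6 : F ((j + 1 : ℕ) * h) - F 0 -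
        h * (∑ i ∈ Finset.range j, F' (i * h) + F' (j * h)) =
        (F ((j + 1 : ℕ) * h) - F (j * h) - h * F' (j * h)) +
          (F (j * h) - F 0 - h * ∑ i ∈ Finset.range j, F' (i * h)) := by ring
    rw [h6]
    refine (abs_add_le _ _).trans ?_
    push_cast at h5 ⊢
    linarith

/-- If the moments of the states `x j` follow the empirical drift up to `δ₁`, their limits follow
the mean-field drift up to `δ₂`, and both start within `δ₀` of each other, they stay close. -/
theorem momentDist_grid_le {K N : ℕ} (M : ℕ) {lam θ : Fin N → ℝ} {c C γ : ℝ}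
    (hC : 0 ≤ C) (hlam : ∀ i, lam i = c * θ i) (hθ0 : ∀ i, 0 ≤ θ i) (hθ1 : ∀ i, θ i ≤ 1)
    (x : ℕ → State K N) {z : ℕ → ℕ → Fin (K + 1) → ℝ} (hz0 : ∀ j a k, 0 ≤ z j a k)
    (hz1 : ∀ j a k, z j a k ≤ 1) (hz : ∀ j, ∑ l : Fin (K + 1), (l : ℝ) * z j 0 l ≤ γ)
    {n m : ℕ} {h δ₀ δ₁ δ₂ : ℝ} (hh : 0 ≤ h) (hδ₀ : 0 ≤ δ₀) (hδ₁ : 0 ≤ δ₁) (hδ₂ : 0 ≤ δ₂)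
    (hinit : ∀ a ≤ m, ∀ k, |moment θ a k (x 0) - z 0 a k| ≤ δ₀)
    (hpath : ∀ a ≤ m, ∀ k, ∀ j ≤ n, |moment θ a k (x j) - moment θ a k (x 0) -
      h * ∑ i ∈ Finset.range j,
        ∑ y, jumpRate M lam (x i) y * (moment θ a k y - moment θ a k (x i))| ≤ δ₁)
    (hlim : ∀ a ≤ m, ∀ k, ∀ j ≤ n, |z j a k - z 0 a k -
      h * ∑ i ∈ Finset.range j, momentDrift C γ (z i) a k| ≤ δ₂) :
    ∀ j ≤ n, momentDist θ (x j) (z j) 0 ≤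
      (2 * ((K + 1) * (δ₀ + δ₁ + δ₂ + n * h * ((K + 1) * (|c - C| + |(M : ℝ) / N - γ|)))) +
        (K + 1) * (C + |γ| + (K + 1) * K) * (n * h) * ((K + 1) / 2 ^ m)) *
      Real.exp (5 * ((K + 1) * (C + |γ| + (K + 1) * K)) * (n * h)) := by
  set L : ℝ := C + |γ| + (K + 1) * K with hL
  have hL0 : 0 ≤ L := by positivity
  set e : ℝ := (K + 1) * (|c - C| + |(M : ℝ) / N - γ|) with he
  have he0 : 0 ≤ e := by positivity
  set S : ℕ → ℕ → ℝ := fun a j => momentDist θ (x j) (z j) a with hS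
  have hrec : ∀ a ≤ m, ∀ j ≤ n, S a j ≤ (K + 1) * (δ₀ + δ₁ + δ₂ + n * h * e) +
      ((K + 1) * L * h) * ∑ i ∈ Finset.range j, (S (a + 1) i + S a i + S 0 i) := by
    intro a ha j hj
    have hk : ∀ k, |moment θ a k (x j) - z j a k| ≤ (δ₀ + δ₁ + δ₂ + n * h * e) +
        L * h * ∑ i ∈ Finset.range j, (S (a + 1) i + S a i + S 0 i) := by
      intro k
      set g : ℕ → ℝ := fun i => ∑ y, jumpRate M lam (x i) y * (moment θ a k y - moment θ a k (x i))
        with hg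
      have h1 : moment θ a k (x j) - z j a k = (moment θ a k (x 0) - z 0 a k) +
          (moment θ a k (x j) - moment θ a k (x 0) - h * ∑ i ∈ Finset.range j, g i) -
          (z j a k - z 0 a k - h * ∑ i ∈ Finset.range j, momentDrift C γ (z i) a k) +
          h * ∑ i ∈ Finset.range j, (g i - momentDrift C γ (z i) a k) := by
        rw [Finset.sum_sub_distrib]; ring
      have h2 : |h * ∑ i ∈ Finset.range j, (g i - momentDrift C γ (z i) a k)| ≤
          n * h * e + L * h * ∑ i ∈ Finset.range j, (S (a + 1) i + S a i + S 0 i) := by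
        rw [abs_mul, abs_of_nonneg hh]
        calc _ ≤ h * ∑ i ∈ Finset.range j, (e + L * (S (a + 1) i + S a i + S 0 i)) := by
              refine mul_le_mul_of_nonneg_left ((Finset.abs_sum_le_sum_abs _ _).trans
                (Finset.sum_le_sum fun i _ => ?_)) hh
              exact abs_generator_moment_sub_le M hC hlam hθ0 hθ1 (x i) (hz0 i) (hz i) a k
          _ = j * h * e + L * h * ∑ i ∈ Finset.range j, (S (a + 1) i + S a i + S 0 i) := by
              rw [Finset.sum_add_distrib, Finset.sum_const, Finset.card_range, nsmul_eq_mul,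
                ← Finset.mul_sum]
              ring
          _ ≤ _ := by gcongr
      rw [h1]
      have h3 := abs_add_le ((moment θ a k (x 0) - z 0 a k) +
          (moment θ a k (x j) - moment θ a k (x 0) - h * ∑ i ∈ Finset.range j, g i) -
          (z j a k - z 0 a k - h * ∑ i ∈ Finset.range j, momentDrift C γ (z i) a k))
          (h * ∑ i ∈ Finset.range j, (g i - momentDrift C γ (z i) a k))
      have h4 := abs_sub ((moment θ a k (x 0) - z 0 a k) +
          (moment θ a k (x j) - moment θ a k (x 0) - h * ∑ i ∈ Finset.range j, g i))
          (z j a k - z 0 a k - h * ∑ i ∈ Finset.range j, momentDrift C γ (z i) a k)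
      have h5 := abs_add_le (moment θ a k (x 0) - z 0 a k)
          (moment θ a k (x j) - moment θ a k (x 0) - h * ∑ i ∈ Finset.range j, g i)
      linarith [hinit a ha k, hpath a ha k j hj, hlim a ha k j hj]
    refine (Finset.sum_le_sum fun k _ => hk k).trans_eq ?_
    rw [Finset.sum_const, Finset.card_univ, Fintype.card_fin, nsmul_eq_mul]
    push_cast; ring
  intro j hj
  -- The step constant carries a factor `h`, so `n` steps produce the elapsed time `n * h` and the
  -- estimate does not degrade with the mesh.
  have := hierarchy_gronwall (S := S) (B := K + 1) (m := m) (fun a j => momentDist_nonneg _ _ _ _)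
    (fun a j => momentDist_le hθ0 hθ1 _ (hz0 j) (hz1 j) a) (by positivity) (by positivity) hrec j hj
  convert this using 2
  · ring
  · ring_nf

/-! ### Dyadic grids -/

theorem exists_dyadic_lt {D : ℝ≥0 → ℝ} {ε : ℝ} {t₀ t : ℝ≥0} (ht₀ : 0 < t₀) (ht : t ≤ t₀)
    (hD : ∀ s, ε < D s → ∀ᶠ u in 𝓝[>] s, ε < D u) (h : ε < D t) :
    ∃ n : ℕ, ∃ j : ℕ, j ≤ 2 ^ n ∧ ε < D ((j : ℝ≥0) * (t₀ / 2 ^ n)) := by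
  -- At `t = t₀` there is no room to the right inside the horizon, but `t₀` is itself a grid point.
  rcases ht.eq_or_lt with rfl | hlt
  · exact ⟨0, 1, le_rfl, by simpa using h⟩
  obtain ⟨u, hu, hsub⟩ := (mem_nhdsGT_iff_exists_Ioo_subset' hlt).1 (hD t h)
  set b : ℝ≥0 := min u t₀ with hb
  have htb : t < b := lt_min hu hlt
  obtain ⟨n, hn⟩ := exists_pow_lt_of_lt_one (div_pos (tsub_pos_of_lt htb) ht₀)
    (show (1 / 2 : ℝ≥0) < 1 from by
      rw [div_lt_one (by norm_num)]; norm_num)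
  set s : ℝ≥0 := t₀ / 2 ^ n with hs
  have hs0 : 0 < s := by positivity
  have hsb : t + s < b := by
    rw [one_div, inv_pow, lt_div_iff₀ ht₀, mul_comm, ← div_eq_mul_inv] at hn
    exact lt_tsub_iff_left.1 hn
  set j : ℕ := ⌊t / s⌋₊ + 1 with hj
  have h1 : t < (j : ℝ≥0) * s := by
    rw [← div_lt_iff₀ hs0, hj]
    push_cast
    exact Nat.lt_floor_add_one _
  have h2 : (j : ℝ≥0) * s ≤ t + s := by
    rw [hj]; push_cast
    rw [add_mul, one_mul]
    gcongr
    rw [← le_div_iff₀ hs0]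
    exact Nat.floor_le zero_le
  refine ⟨n, j, ?_, hsub ⟨h1, (h2.trans_lt hsb).trans_le (min_le_left _ _)⟩⟩
  have h3 : (j : ℝ≥0) * s ≤ t₀ := (h2.trans hsb.le).trans (min_le_right _ _)
  rw [hs, ← mul_div_assoc, div_le_iff₀ (by positivity), mul_comm] at h3
  have h4 := le_of_mul_le_mul_left h3 ht₀
  exact_mod_cast h4

/-- Dyadic grids are nested, so the events increase with `n`: continuity from below needs the bound
only for large `n`. -/
theorem measure_lt_iSup_le {Ω : Type*} {mΩ : MeasurableSpace Ω} {P : Measure Ω}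
    {D : ℝ≥0 → Ω → ℝ} {ε : ℝ} {t₀ : ℝ≥0} (ht₀ : 0 < t₀)
    (hD : ∀ ω s, ε < D s ω → ∀ᶠ u in 𝓝[>] s, ε < D u ω) {b : ℝ≥0∞}
    (hb : ∀ᶠ n : ℕ in atTop,
      P {ω | ∃ j : ℕ, j ≤ 2 ^ n ∧ ε < D ((j : ℝ≥0) * (t₀ / 2 ^ n)) ω} ≤ b) :
    P {ω | ∃ t ≤ t₀, ε < D t ω} ≤ b := by
  set A : ℕ → Set Ω := fun n => {ω | ∃ j : ℕ, j ≤ 2 ^ n ∧ ε < D ((j : ℝ≥0) * (t₀ / 2 ^ n)) ω} with hA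
  have hmono : Monotone A := by
    refine monotone_nat_of_le_succ fun n => ?_
    rintro ω ⟨j, hj, h⟩
    refine ⟨2 * j, by rw [pow_succ]; omega, ?_⟩
    have : ((2 * j : ℕ) : ℝ≥0) * (t₀ / 2 ^ (n + 1)) = (j : ℝ≥0) * (t₀ / 2 ^ n) := by
      push_cast; rw [pow_succ]; field_simp
    rwa [this]
  have hsub : {ω | ∃ t ≤ t₀, ε < D t ω} ⊆ ⋃ n, A n := by
    rintro ω ⟨t, ht, h⟩
    obtain ⟨n, hn⟩ := exists_dyadic_lt (D := fun s => D s ω) ht₀ ht (hD ω) h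
    exact mem_iUnion.2 ⟨n, hn⟩
  refine (measure_mono hsub).trans ?_
  rw [hmono.measure_iUnion]
  refine iSup_le fun n => ?_
  obtain ⟨n', hn', hle⟩ := (hb.and (eventually_ge_atTop n)).exists
  exact (measure_mono (hmono hle)).trans hn'

/-! ### Relative utilizations and the initial condition -/

theorem maxUtilization_pos {N : ℕ} (hN : 0 < N) {lam : Fin N → ℝ} (hlam : ∀ i, 0 < lam i) :
    0 < maxUtilization lam := by
  have hN' : (0 : ℝ) < N := by exact_mod_cast hN
  have h1 : 0 < utilization lam ⟨0, hN⟩ := div_pos (by positivity) (hlam _)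
  exact h1.trans_le (le_ciSup (finite_range _).bddAbove _)

theorem relUtilization_le_one {N : ℕ} {lam : Fin N → ℝ} (hlam : ∀ i, 0 < lam i) (i : Fin N) :
    relUtilization lam i ≤ 1 :=
  (div_le_one (maxUtilization_pos (Fin.pos i) hlam)).2 (le_ciSup (finite_range _).bddAbove _)

theorem relUtilization_eq {N : ℕ} {lam : Fin N → ℝ} {Λ : ℝ} (hΛ : 0 < Λ) (i : Fin N) :
    relUtilization lam i = Λ / (Λ * (N * maxUtilization lam) * lam i) := by
  unfold relUtilization utilization
  rw [mul_assoc, div_mul_cancel_left₀ hΛ.ne', div_div, div_div, one_div]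
  congr 1; ring

theorem integral_empiricalMeasure {K N : ℕ} (r : Fin N → ℝ) (x : State K N) (k : Fin (K + 1))
    (f : ℝ →ᵇ ℝ) : ∫ ρ, f ρ ∂(empiricalMeasure r x k) =
      (1 / (N : ℝ)) * ∑ i, f (r i) * if x i = k then 1 else 0 := by
  unfold empiricalMeasure
  rw [integral_smul_measure, integral_finsetSum_measure]
  · rw [smul_eq_mul, ENNReal.toReal_inv, ENNReal.toReal_natCast, one_div]
    congr 1
    refine Finset.sum_congr rfl fun i _ => ?_
    split_ifs <;> simp
  · intro i _
    split_ifs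
    · exact f.integrable _
    · exact integrable_zero_measure

/-- Finitely many exceptional events eventually have total probability below `1`, which leaves a
good sample point. Deterministic constraints on the states thus pass to the limits. -/
theorem exists_subseq_tendsto {Ω : Type*} {mΩ : MeasurableSpace Ω} {P : Measure Ω}
    [IsProbabilityMeasure P] {ι : Type*} [Finite ι] {f : ι → ℕ → Ω → ℝ} {a : ι → ℝ}
    (hf : ∀ i, TendstoInMeasure P (f i) atTop fun _ => a i) {p : ℕ → Ω → Prop}
    (hp : ∀ᶠ N in atTop, ∀ᵐ ω ∂P, p N ω) :
    ∃ φ : ℕ → ℕ, StrictMono φ ∧ ∃ ω : ℕ → Ω, (∀ m, p (φ m) (ω m)) ∧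
      ∀ i, Tendsto (fun m => f i (φ m) (ω m)) atTop (𝓝 (a i)) := by
  have := Fintype.ofFinite ι
  have hev : ∀ m : ℕ, ∀ᶠ N in atTop, ∃ ω, p N ω ∧ ∀ i, |f i N ω - a i| < 1 / ((m : ℝ) + 1) := by
    intro m
    have hε : 0 < ENNReal.ofReal (1 / ((m : ℝ) + 1)) := ENNReal.ofReal_pos.2 (by positivity)
    have hsum : Tendsto (fun N => ∑ i, P {ω | ENNReal.ofReal (1 / ((m : ℝ) + 1)) ≤
        edist (f i N ω) (a i)}) atTop (𝓝 0) := by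
      have := tendsto_finsetSum (Finset.univ : Finset ι) fun i _ => hf i _ hε
      simpa using this
    filter_upwards [hp, hsum.eventually (gt_mem_nhds one_pos)] with N hN hN1
    by_contra hcon
    push Not at hcon
    have hall : ∀ᵐ ω ∂P, ω ∈ ⋃ i, {ω | ENNReal.ofReal (1 / ((m : ℝ) + 1)) ≤
        edist (f i N ω) (a i)} := by
      filter_upwards [hN] with ω hω
      obtain ⟨i, hi⟩ := hcon ω hω
      refine mem_iUnion.2 ⟨i, ?_⟩
      rw [mem_ofPred_eq, edist_dist, Real.dist_eq]
      exact ENNReal.ofReal_le_ofReal hi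
    have h1 : (1 : ℝ≥0∞) ≤ P (⋃ i, {ω | ENNReal.ofReal (1 / ((m : ℝ) + 1)) ≤
        edist (f i N ω) (a i)}) := by
      rw [← measure_univ (μ := P)]
      exact measure_mono_ae (by filter_upwards [hall] with ω hω _ using hω)
    exact absurd (h1.trans (measure_iUnion_fintype_le _ _)) (not_le.2 hN1)
  obtain ⟨φ, hφ, hφ'⟩ := extraction_forall_of_eventually hev
  choose ω hω1 hω2 using hφ'
  refine ⟨φ, hφ, ω, hω1, fun i => ?_⟩
  refine tendsto_iff_dist_tendsto_zero.2 (squeeze_zero (fun _ => dist_nonneg)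
    (fun m => (hω2 m i).le) tendsto_one_div_add_atTop_nhds_zero_nat)

theorem initial_measure_facts {Ω : Type*} {mΩ : MeasurableSpace Ω} {P : Measure Ω}
    [IsProbabilityMeasure P] {K : ℕ} {M : ℕ → ℕ} {lam : (N : ℕ) → Fin N → ℝ}
    {x : (N : ℕ) → Ω → State K N} (hM : ∀ N, ∀ᵐ ω ∂P, ∑ i, (x N ω i : ℕ) ≤ M N) {γ c : ℝ}
    (hγ : Tendsto (fun N => (M N : ℝ) / (N : ℝ)) atTop (𝓝 γ))
    (hrange : ∀ᶠ N in atTop, ∀ i, relUtilization (lam N) i ∈ Icc c 1)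
    {y₀ : Fin (K + 1) → Measure ℝ} [∀ k, IsFiniteMeasure (y₀ k)]
    (hy₀ : ∀ (k : Fin (K + 1)) (f : ℝ →ᵇ ℝ), TendstoInMeasure P
      (fun N ω => ∫ r, f r ∂(empiricalMeasure (relUtilization (lam N)) (x N ω) k))
      atTop (fun _ => ∫ r, f r ∂(y₀ k))) :
    (∀ k, y₀ k (Icc c 1)ᶜ = 0) ∧ ∑ k, (y₀ k).real univ = 1 ∧
      ∑ n : Fin (K + 1), (n : ℝ) * (y₀ n).real univ ≤ γ := by
  constructor
  · intro k
    -- A nonnegative test function whose zero set is exactly `[c, 1]`.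
    set g : ℝ →ᵇ ℝ := BoundedContinuousFunction.ofNormedAddCommGroup
      (fun r => min 1 (max 0 (c - r) + max 0 (r - 1))) (by fun_prop) 1 (fun r => by
        rw [Real.norm_of_nonneg (le_min zero_le_one (add_nonneg (le_max_left _ _)
          (le_max_left _ _)))]
        exact min_le_left _ _) with hg
    have hg0 : ∀ r, 0 ≤ g r := fun r => le_min zero_le_one
      (add_nonneg (le_max_left _ _) (le_max_left _ _))
    obtain ⟨φ, -, ω, hω, hlim⟩ := exists_subseq_tendsto (fun k => hy₀ k g)
      (p := fun N _ => ∀ i, relUtilization (lam N) i ∈ Icc c 1)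
      (hrange.mono fun N hN => ae_of_all _ fun _ => hN)
    have hzero : ∫ r, g r ∂(y₀ k) = 0 := by
      refine tendsto_nhds_unique (hlim k) (tendsto_const_nhds.congr fun m => ?_)
      rw [integral_empiricalMeasure]
      symm
      refine mul_eq_zero_of_right _ (Finset.sum_eq_zero fun i _ => mul_eq_zero_of_left ?_ _)
      have := hω m i
      change min 1 (max 0 (c - relUtilization (lam (φ m)) i) +
        max 0 (relUtilization (lam (φ m)) i - 1)) = 0
      rw [max_eq_left (by linarith [this.1]), max_eq_left (by linarith [this.2])]
      simp
    have hae := (integral_eq_zero_iff_of_nonneg hg0 (g.integrable (y₀ k))).1 hzero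
    refine measure_mono_null (fun r hr => ?_) hae
    intro h0
    refine hr ?_
    have h1 : min 1 (max 0 (c - r) + max 0 (r - 1)) = 0 := h0
    have h2 : max 0 (c - r) + max 0 (r - 1) ≤ 0 := by
      by_contra hpos
      exact absurd h1 (lt_min one_pos (not_le.1 hpos)).ne'
    have h3 := le_max_left 0 (c - r)
    have h4 := le_max_left 0 (r - 1)
    have h5 := le_max_right 0 (c - r)
    have h6 := le_max_right 0 (r - 1)
    exact ⟨by linarith, by linarith⟩
  · have hone : ∀ k, ∫ r, (1 : ℝ →ᵇ ℝ) r ∂(y₀ k) = (y₀ k).real univ := fun k => by simp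
    obtain ⟨φ, hφ, ω, hω, hlim⟩ := exists_subseq_tendsto (fun k => hy₀ k 1)
      (p := fun N ω => 0 < N ∧ ∑ i, (x N ω i : ℕ) ≤ M N) (by
        filter_upwards [eventually_gt_atTop 0] with N hN
        filter_upwards [hM N] with ω hω using ⟨hN, hω⟩)
    have hmom : ∀ (k : Fin (K + 1)) m, ∫ r, (1 : ℝ →ᵇ ℝ) r ∂(empiricalMeasure
        (relUtilization (lam (φ m))) (x (φ m) (ω m)) k) = moment 1 0 k (x (φ m) (ω m)) :=
      fun k m => by rw [integral_empiricalMeasure]; simp [moment]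
    simp only [hone, hmom] at hlim
    constructor
    · refine tendsto_nhds_unique (tendsto_finsetSum Finset.univ fun k _ => hlim k)
        (tendsto_const_nhds.congr fun m => ?_)
      rw [sum_moment_zero (hω m).1]
    · refine le_of_tendsto_of_tendsto' (tendsto_finsetSum Finset.univ fun (n : Fin (K + 1)) _ =>
        (hlim n).const_mul (n : ℝ)) (hγ.comp hφ.tendsto_atTop) fun m => ?_
      rw [sum_mul_moment_zero, one_div_mul_eq_div]
      have : (∑ j, ((x (φ m) (ω m) j : ℕ) : ℝ)) ≤ M (φ m) := by exact_mod_cast (hω m).2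
      simp only [Function.comp_apply]
      gcongr

/-! ### Convergence to the mean-field limit -/

theorem proportions_eq {K N : ℕ} (θ : Fin N → ℝ) (x : State K N) :
    proportions x = WithLp.toLp 2 fun k => moment θ 0 k x := by
  simp [proportions, moment]

theorem norm_toLp_sub_le_momentDist {K N : ℕ} (θ : Fin N → ℝ) (x : State K N)
    (z : ℕ → Fin (K + 1) → ℝ) :
    ‖proportions x - WithLp.toLp 2 (z 0)‖ ≤ momentDist θ x z 0 := by
  rw [proportions_eq θ, EuclideanSpace.norm_eq, Real.sqrt_le_left (momentDist_nonneg _ _ _ _)]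
  unfold momentDist
  exact Finset.sum_sq_le_sq_sum_of_nonneg fun k _ => abs_nonneg _

/-- Order of choices: the truncation level `m`, leaving finitely many moments; then `N` large for
the tolerance `δ`; then a fine enough grid depending on `N`. The probability bound does not depend
on the grid. -/
theorem tendsto_measure_lt_iSup {Ω : Type*} {mΩ : MeasurableSpace Ω} {P : Measure Ω}
    [IsProbabilityMeasure P] {K : ℕ} {M : ℕ → ℕ} {lam θ : (N : ℕ) → Fin N → ℝ}
    {X : (N : ℕ) → ℝ≥0 → Ω → State K N}
    (hX : ∀ N, IsCTMC P (generator (jumpRate (M N) (lam N))) (X N)) {C C' γ : ℝ} {c : ℕ → ℝ}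
    (hlam0 : ∀ N i, 0 ≤ lam N i) (hlamC : ∀ N i, lam N i ≤ C') (hC : 0 ≤ C)
    (hlam : ∀ᶠ N in atTop, ∀ i, lam N i = c N * θ N i) (hθ0 : ∀ N i, 0 ≤ θ N i)
    (hθ1 : ∀ N i, θ N i ≤ 1) (hc : Tendsto c atTop (𝓝 C))
    (hγ : Tendsto (fun N => (M N : ℝ) / (N : ℝ)) atTop (𝓝 γ))
    {z : ℝ → ℕ → Fin (K + 1) → ℝ} (hz0 : ∀ t, 0 ≤ t → ∀ a k, 0 ≤ z t a k)
    (hz1 : ∀ t, 0 ≤ t → ∀ a k, z t a k ≤ 1)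
    (hzγ : ∀ t, 0 ≤ t → ∑ l : Fin (K + 1), (l : ℝ) * z t 0 l ≤ γ)
    (hz : ∀ t, 0 ≤ t → ∀ a k,
      HasDerivWithinAt (fun s => z s a k) (momentDrift C γ (z t) a k) (Ici 0) t)
    (hinit : ∀ a k, TendstoInMeasure P (fun N ω => moment (θ N) a k (X N 0 ω)) atTop
      fun _ => z 0 a k) {ε : ℝ} (hε : 0 < ε) {t₀ : ℝ≥0} (ht₀ : 0 < t₀) :
    Tendsto (fun N => P {ω | ∃ t ≤ t₀,
      ε < ‖proportions (X N t ω) - WithLp.toLp 2 (z t 0)‖}) atTop (𝓝 0) := by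
  have hT : (0 : ℝ) < t₀ := NNReal.coe_pos.2 ht₀
  set L : ℝ := (K + 1) * (C + |γ| + (K + 1) * K) with hL
  have hL0 : 0 ≤ L := by positivity
  set W : ℝ := Real.exp (5 * L * t₀) with hW
  have hW0 : 0 < W := Real.exp_pos _
  -- Chosen so that `16 * (K + 1) * δ * W = ε / 2`; the hierarchy tail uses the other half.
  set δ : ℝ := ε / (32 * (K + 1) * W) with hδ
  have hδ0 : 0 < δ := by positivity
  obtain ⟨m, hm⟩ : ∃ m : ℕ, L * t₀ * ((K + 1) / 2 ^ m) * W < ε / 2 := by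
    have h1 : Tendsto (fun m : ℕ => L * t₀ * ((K + 1) / 2 ^ m) * W) atTop (𝓝 0) := by
      have h2 := (tendsto_const_nhds (x := (K + 1 : ℝ))).div_atTop
        (tendsto_pow_atTop_atTop_of_one_lt (one_lt_two (α := ℝ)))
      simpa using (h2.const_mul (L * t₀)).mul_const W
    exact (h1.eventually (gt_mem_nhds (half_pos hε))).exists
  set J : Finset (ℕ × Fin (K + 1)) := Finset.range (m + 1) ×ˢ Finset.univ with hJ
  have hmemJ : ∀ a ≤ m, ∀ k : Fin (K + 1), (a, k) ∈ J := fun a ha k =>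
    Finset.mem_product.2 ⟨Finset.mem_range.2 (Nat.lt_succ_of_le ha), Finset.mem_univ _⟩
  set Γ : ℕ → ℝ := fun N => (C' + (M N : ℝ) / N) / N with hΓ
  set bound : ℕ → ℝ≥0∞ := fun N => ∑ q ∈ J,
    (P {ω | ENNReal.ofReal δ ≤ edist (moment (θ N) q.1 q.2 (X N 0 ω)) (z 0 q.1 q.2)} +
      ENNReal.ofReal (t₀ * (Γ N + 1 / N) / δ ^ 2)) with hbound
  have hbound0 : Tendsto bound atTop (𝓝 0) := by
    have h1 : Tendsto (fun N : ℕ => ENNReal.ofReal (t₀ * (Γ N + 1 / N) / δ ^ 2)) atTop (𝓝 0) := by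
      have h2 : Tendsto Γ atTop (𝓝 0) :=
        (hγ.const_add C').div_atTop tendsto_natCast_atTop_atTop
      have h3 := ((h2.add tendsto_one_div_atTop_nhds_zero_nat).const_mul (t₀ : ℝ)).div_const (δ ^ 2)
      simp only [add_zero, mul_zero, zero_div] at h3
      simpa using ENNReal.tendsto_ofReal h3
    have h4 := tendsto_finsetSum J fun q _ =>
      (hinit q.1 q.2 _ (ENNReal.ofReal_pos.2 hδ0)).add h1
    simp only [add_zero, Finset.sum_const_zero] at h4
    exact h4
  have herr : Tendsto (fun N => (t₀ : ℝ) * ((K + 1) * (|c N - C| + |(M N : ℝ) / N - γ|)))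
      atTop (𝓝 0) := by
    have h1 : Tendsto (fun N => |c N - C|) atTop (𝓝 0) := by
      simpa using (hc.sub_const C).abs
    have h2 : Tendsto (fun N => |(M N : ℝ) / N - γ|) atTop (𝓝 0) := by
      simpa using (hγ.sub_const γ).abs
    simpa using ((h1.add h2).const_mul (K + 1 : ℝ)).const_mul (t₀ : ℝ)
  have hinv : Tendsto (fun N : ℕ => (t₀ : ℝ) * (1 / N)) atTop (𝓝 0) := by
    simpa using tendsto_one_div_atTop_nhds_zero_nat.const_mul (t₀ : ℝ)
  refine tendsto_of_tendsto_of_tendsto_of_le_of_le' tendsto_const_nhds hbound0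
    (Eventually.of_forall fun _ => zero_le) ?_
  filter_upwards [hlam, eventually_gt_atTop 0, herr.eventually (gt_mem_nhds hδ0),
    hinv.eventually (gt_mem_nhds hδ0)] with N hlamN hN herrN hinvN
  have hzc : ∀ a k, ContinuousOn (fun s => z s a k) (Ici 0) := fun a k t ht =>
    (hz t ht a k).continuousWithinAt
  -- right continuity
  have hright : ∀ ω (s : ℝ≥0), ε < ‖proportions (X N s ω) - WithLp.toLp 2 (z s 0)‖ →
      ∀ᶠ u : ℝ≥0 in 𝓝[>] s, ε < ‖proportions (X N u ω) - WithLp.toLp 2 (z u 0)‖ := by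
    intro ω s hs
    have hcont : Continuous fun u : ℝ≥0 =>
        ‖proportions (X N s ω) - WithLp.toLp 2 (z (u : ℝ) 0)‖ := by
      refine (continuous_const.sub ((PiLp.continuous_toLp 2 _).comp
        (continuous_pi fun k => ?_))).norm
      exact (hzc 0 k).comp_continuous NNReal.continuous_coe fun u => u.2
    have h1 := (hcont.tendsto s).eventually (lt_mem_nhds hs)
    filter_upwards [(hX N).right_continuous ω s, h1.filter_mono nhdsWithin_le_nhds] with u hu1 hu2
    rwa [hu1]
  refine measure_lt_iSup_le ht₀ hright ?_
  -- the grid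
  have hgrid0 : Tendsto (fun n : ℕ => (t₀ : ℝ) / 2 ^ n) atTop (𝓝 0) :=
    tendsto_const_nhds.div_atTop (tendsto_pow_atTop_atTop_of_one_lt one_lt_two)
  have hgrid' : Tendsto (fun n : ℕ => (t₀ : ℝ) / 2 ^ n) atTop (𝓝[>] 0) :=
    tendsto_nhdsWithin_iff.2 ⟨hgrid0, Eventually.of_forall fun n => by
      simp only [mem_Ioi]; positivity⟩
  have hgrid : Tendsto (fun n : ℕ => t₀ / 2 ^ n) atTop (𝓝[>] 0) :=
    tendsto_nhdsWithin_iff.2 ⟨NNReal.tendsto_coe.1 (by simpa using hgrid0),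
      Eventually.of_forall fun n => by simp only [mem_Ioi]; positivity⟩
  have hN' : (0 : ℝ) < N := by exact_mod_cast hN
  -- The one-step tolerance is `1 / N`: over the whole horizon it adds up to `t₀ / N < δ`, whence
  -- the path error `2 * δ` below.
  have hmart : ∀ᶠ n : ℕ in atTop, ∀ q ∈ J, ∀ n' : ℕ, ∀ δ : ℝ, 0 < δ →
      P {ω | ∃ j ≤ n', δ + n' * ((t₀ / 2 ^ n : ℝ≥0) : ℝ) * (1 / N) ≤
        |moment (θ N) q.1 q.2 (X N (j * (t₀ / 2 ^ n)) ω) - moment (θ N) q.1 q.2 (X N 0 ω) -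
        ((t₀ / 2 ^ n : ℝ≥0) : ℝ) * ∑ i ∈ Finset.range j,
          ∑ y, jumpRate (M N) (lam N) (X N (i * (t₀ / 2 ^ n)) ω) y *
            (moment (θ N) q.1 q.2 y - moment (θ N) q.1 q.2 (X N (i * (t₀ / 2 ^ n)) ω))|} ≤
        ENNReal.ofReal (n' * ((t₀ / 2 ^ n : ℝ≥0) : ℝ) * (Γ N + 1 / N) / δ ^ 2) := by
    rw [Finset.eventually_all]
    intro q _
    exact hgrid.eventually ((hX N).eventually_measure_le (moment (θ N) q.1 q.2)
      (fun x => sum_jumpRate_moment_sq_le hN (M N) (hlam0 N) (hlamC N)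
        (fun i => by rw [abs_of_nonneg (hθ0 N i)]; exact hθ1 N i) q.1 q.2 x)
      (one_div_pos.2 hN'))
  have hriem : ∀ᶠ n : ℕ in atTop, ∀ q ∈ J, ∀ n' : ℕ, n' * ((t₀ : ℝ) / 2 ^ n) ≤ t₀ → ∀ j ≤ n',
      |z (j * ((t₀ : ℝ) / 2 ^ n)) q.1 q.2 - z 0 q.1 q.2 - (t₀ : ℝ) / 2 ^ n *
        ∑ i ∈ Finset.range j, momentDrift C γ (z (i * ((t₀ : ℝ) / 2 ^ n))) q.1 q.2| ≤
        j * ((t₀ : ℝ) / 2 ^ n) * (δ / t₀) := by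
    rw [Finset.eventually_all]
    intro q _
    refine hgrid'.eventually (eventually_abs_sub_riemann_le (fun t ht => hz t ht q.1 q.2) ?_
      (div_pos hδ0 hT))
    unfold momentDrift
    have hzc' : ∀ a k, ContinuousOn (fun s => z s a k) (Icc 0 (t₀ : ℝ)) := fun a k =>
      (hzc a k).mono Icc_subset_Ici_self
    refine continuousOn_finsetSum _ fun n _ => ContinuousOn.add ?_ ?_
    · exact continuousOn_const.mul (continuousOn_const.mul (hzc' _ _))
    · exact continuousOn_const.mul ((continuousOn_const.sub
        (continuousOn_finsetSum _ fun l _ => continuousOn_const.mul (hzc' _ _))).mul (hzc' _ _))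
  filter_upwards [hmart, hriem] with n hmartn hriemn
  have hcoe : ((t₀ / 2 ^ n : ℝ≥0) : ℝ) = (t₀ : ℝ) / 2 ^ n := by push_cast; rfl
  -- Number of steps times mesh is `t₀`, which frees the bound from `n`.
  have hnh : ((2 ^ n : ℕ) : ℝ) * ((t₀ : ℝ) / 2 ^ n) = t₀ := by push_cast; field_simp
  set bad : ℕ × Fin (K + 1) → Set Ω := fun q =>
    {ω | ENNReal.ofReal δ ≤ edist (moment (θ N) q.1 q.2 (X N 0 ω)) (z 0 q.1 q.2)} ∪
    {ω | ∃ j : ℕ, j ≤ 2 ^ n ∧ δ + (2 ^ n : ℕ) * ((t₀ / 2 ^ n : ℝ≥0) : ℝ) * (1 / N) ≤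
        |moment (θ N) q.1 q.2 (X N (j * (t₀ / 2 ^ n)) ω) - moment (θ N) q.1 q.2 (X N 0 ω) -
        ((t₀ / 2 ^ n : ℝ≥0) : ℝ) * ∑ i ∈ Finset.range j,
          ∑ y, jumpRate (M N) (lam N) (X N (i * (t₀ / 2 ^ n)) ω) y *
            (moment (θ N) q.1 q.2 y - moment (θ N) q.1 q.2 (X N (i * (t₀ / 2 ^ n)) ω))|} with hbad
  have hPbad : P (⋃ q ∈ J, bad q) ≤ bound N := by
    refine (measure_biUnion_finset_le J bad).trans (Finset.sum_le_sum fun q hq => ?_)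
    refine (measure_union_le _ _).trans (add_le_add le_rfl ?_)
    exact (hmartn q hq (2 ^ n) δ hδ0).trans_eq (by rw [hcoe, hnh])
  refine (measure_mono ?_).trans hPbad
  rintro ω ⟨j, hj, hω⟩
  by_contra hgood
  refine absurd hω (not_lt.2 ?_)
  have hgood' : ∀ q ∈ J, ω ∉ bad q := fun q hq hmem => hgood (mem_biUnion hq hmem)
  have hinit' : ∀ a ≤ m, ∀ k, |moment (θ N) a k (X N 0 ω) - z 0 a k| ≤ δ := by
    intro a ha k
    have h1 : edist (moment (θ N) a k (X N 0 ω)) (z 0 a k) < ENNReal.ofReal δ :=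
      not_le.1 fun h => hgood' _ (hmemJ a ha k) (Or.inl h)
    rw [edist_dist, Real.dist_eq] at h1
    exact ((ENNReal.ofReal_lt_ofReal_iff hδ0).1 h1).le
  have hpath' : ∀ a ≤ m, ∀ k, ∀ j : ℕ, j ≤ 2 ^ n → |moment (θ N) a k (X N (j * (t₀ / 2 ^ n)) ω) -
      moment (θ N) a k (X N 0 ω) - (t₀ : ℝ) / 2 ^ n * ∑ i ∈ Finset.range j,
        ∑ y, jumpRate (M N) (lam N) (X N (i * (t₀ / 2 ^ n)) ω) y *
          (moment (θ N) a k y - moment (θ N) a k (X N (i * (t₀ / 2 ^ n)) ω))| ≤ 2 * δ := by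
    intro a ha k j hj
    by_contra hcon
    push Not at hcon
    refine hgood' _ (hmemJ a ha k) (Or.inr ⟨j, hj, ?_⟩)
    rw [hcoe, hnh]
    refine le_trans ?_ hcon.le
    linarith
  have hlim' : ∀ a ≤ m, ∀ k, ∀ j : ℕ, j ≤ 2 ^ n → |z (j * ((t₀ : ℝ) / 2 ^ n)) a k - z 0 a k -
      (t₀ : ℝ) / 2 ^ n * ∑ i ∈ Finset.range j,
        momentDrift C γ (z (i * ((t₀ : ℝ) / 2 ^ n))) a k| ≤ δ := by
    intro a ha k j hj
    refine (hriemn _ (hmemJ a ha k) (2 ^ n) hnh.le j hj).trans ?_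
    have h1 : (j : ℝ) * ((t₀ : ℝ) / 2 ^ n) ≤ t₀ :=
      (mul_le_mul_of_nonneg_right (Nat.cast_le.2 hj) (by positivity)).trans_eq hnh
    calc _ ≤ (t₀ : ℝ) * (δ / t₀) := by gcongr
      _ = δ := by field_simp
  have hnn : ∀ j : ℕ, (0 : ℝ) ≤ j * ((t₀ : ℝ) / 2 ^ n) := fun j => by positivity
  have hfinal := momentDist_grid_le (M N) hC hlamN (hθ0 N) (hθ1 N)
    (fun j => X N (j * (t₀ / 2 ^ n)) ω) (z := fun j => z (j * ((t₀ : ℝ) / 2 ^ n)))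
    (fun j => hz0 _ (hnn j)) (fun j => hz1 _ (hnn j)) (fun j => hzγ _ (hnn j))
    (n := 2 ^ n) (m := m) (h := (t₀ : ℝ) / 2 ^ n) (by positivity) hδ0.le
    (by positivity : 0 ≤ 2 * δ) hδ0.le (by simpa using hinit') (by simpa using hpath')
    (by simpa using hlim') j hj
  rw [hnh] at hfinal
  have hcast : (((j : ℝ≥0) * (t₀ / 2 ^ n) : ℝ≥0) : ℝ) = j * ((t₀ : ℝ) / 2 ^ n) := by
    push_cast; rfl
  rw [hcast]
  refine (norm_toLp_sub_le_momentDist (θ N) _ (z (j * ((t₀ : ℝ) / 2 ^ n)))).trans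
    (hfinal.trans ?_)
  have h1 : 2 * ((K + 1) * (δ + 2 * δ + δ + t₀ * ((K + 1) * (|c N - C| +
      |(M N : ℝ) / N - γ|)))) ≤ 16 * (K + 1) * δ := by
    have : (K + 1 : ℝ) * (δ + 2 * δ + δ + t₀ * ((K + 1) * (|c N - C| +
        |(M N : ℝ) / N - γ|))) ≤ (K + 1) * (8 * δ) :=
      mul_le_mul_of_nonneg_left (by linarith) (by positivity)
    linarith
  have h2 : 16 * (K + 1) * δ * W = ε / 2 := by
    rw [hδ]; field_simp; norm_num
  calc _ ≤ (16 * (K + 1) * δ + L * t₀ * ((K + 1) / 2 ^ m)) * W :=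
        mul_le_mul_of_nonneg_right (add_le_add h1 le_rfl) hW0.le
    _ ≤ ε := by rw [add_mul, h2]; linarith

theorem pairing_mem_Icc {K : ℕ} {μ : Fin (K + 1) → Measure ℝ} [∀ j, IsFiniteMeasure (μ j)]
    (hμ : ∑ j, (μ j).real univ = 1) {g : ℝ →ᵇ ℝ} (hg : ∀ r, g r ∈ Icc (0 : ℝ) 1)
    {p : TransitionFamily K} (hp : ∀ j k r, 0 ≤ p j k r) (hp1 : ∀ j r, ∑ k, p j k r = 1)
    (k : Fin (K + 1)) : pairing μ g p k ∈ Icc (0 : ℝ) 1 := by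
  constructor
  · exact Finset.sum_nonneg fun j _ => integral_nonneg fun r => mul_nonneg (hg r).1 (hp j k r)
  · rw [← hμ]
    refine Finset.sum_le_sum fun j _ => ?_
    have hp' : ∀ r, p j k r ≤ 1 := fun r => (hp1 j r).symm ▸
      Finset.single_le_sum (f := fun k => p j k r) (fun k _ => hp j k r) (Finset.mem_univ k)
    calc ∫ r, (g * p j k) r ∂(μ j) ≤ ∫ _, (1 : ℝ) ∂(μ j) :=
          integral_mono ((g * p j k).integrable _) (integrable_const _)
            fun r => mul_le_one₀ (hg r).2 (hp j k r) (hp' r)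
      _ = (μ j).real univ := by simp

theorem lt_iSup_enorm_iff {E : Type*} [NormedAddCommGroup E] {f : ℝ≥0 → E} {ε : ℝ} (hε : 0 ≤ ε)
    (t₀ : ℝ≥0) : ENNReal.ofReal ε < ⨆ (t : ℝ≥0) (_ : t ≤ t₀), ‖f t‖ₑ ↔ ∃ t ≤ t₀, ε < ‖f t‖ := by
  simp only [lt_iSup_iff, exists_prop, ← ofReal_norm,
    ENNReal.ofReal_lt_ofReal_iff_of_nonneg hε]

/-- With `κ = Λ * N * R_max → 1` one has `r i = Λ / (κ * lam i)`. Once `κ < 2`, the bound `lam i ≤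
C` gives `r i ≥ Λ / (2 * C)`, and there `lam i = (2 * C / κ) * w (r i)`. -/
theorem exists_rate_bound {lam : (N : ℕ) → Fin N → ℝ} (hlam : ∀ N i, 0 < lam N i)
    (hbdd : ∃ C : ℝ, ∀ N i, lam N i ≤ C) {Λ : ℝ} (hΛ : 0 < Λ)
    (hR : Tendsto (fun N : ℕ => (N : ℝ) * maxUtilization (lam N)) atTop (𝓝 Λ⁻¹)) :
    ∃ (C c : ℝ) (hc : 0 < c) (C' : ℝ) (s : ℕ → ℝ), 0 ≤ C ∧ C * c = Λ ∧
      (∀ N i, lam N i ≤ C') ∧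
      (∀ᶠ N in atTop, ∀ i, relUtilization (lam N) i ∈ Icc c 1) ∧
      (∀ᶠ N in atTop, ∀ i, lam N i = s N * inverseWeight c hc (relUtilization (lam N) i)) ∧
      Tendsto s atTop (𝓝 C) := by
  obtain ⟨C, hC⟩ := hbdd
  have hC0 : 0 < C := (hlam 1 0).trans_le (hC 1 0)
  have hc : 0 < Λ / (2 * C) := by positivity
  set κ : ℕ → ℝ := fun N => Λ * (N * maxUtilization (lam N)) with hκ
  have hκ1 : Tendsto κ atTop (𝓝 1) := by
    simpa [hΛ.ne'] using hR.const_mul Λ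
  have hev : ∀ᶠ N in atTop, 0 < κ N ∧ κ N < 2 :=
    (hκ1.eventually (lt_mem_nhds one_pos)).and (hκ1.eventually (gt_mem_nhds one_lt_two))
  have hrange : ∀ᶠ N in atTop, ∀ i, relUtilization (lam N) i ∈ Icc (Λ / (2 * C)) 1 := by
    filter_upwards [hev] with N hN i
    refine ⟨?_, relUtilization_le_one (hlam N) i⟩
    rw [relUtilization_eq hΛ]
    have := hlam N i
    exact div_le_div_of_nonneg_left hΛ.le (mul_pos hN.1 this)
      (mul_le_mul hN.2.le (hC N i) this.le zero_le_two)
  refine ⟨2 * C, Λ / (2 * C), hc, C, fun N => 2 * C / κ N, by positivity,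
    by field_simp, hC, hrange, ?_, ?_⟩
  · filter_upwards [hev, hrange] with N hN hr i
    rw [inverseWeight_apply, max_eq_left (hr i).1, relUtilization_eq hΛ]
    have h1 := hN.1
    have h2 := hlam N i
    change lam N i = 2 * C / κ N * (Λ / (2 * C) / (Λ / (κ N * lam N i)))
    field_simp
  · have := (tendsto_const_nhds (x := 2 * C)).div hκ1 one_ne_zero
    rwa [div_one] at this

end BikeSharing

end

/-! ### Proof of the theorem. -/

open BikeSharing in
theorem theorem2 {Ω : Type*} [MeasurableSpace Ω] (P : Measure Ω) [IsProbabilityMeasure P]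
    (K : ℕ) (M : ℕ → ℕ) (lam : (N : ℕ) → Fin N → ℝ) (hlam : ∀ N i, 0 < lam N i)
    -- arrival rates are uniformly bounded
    (hbdd : ∃ C : ℝ, ∀ N i, lam N i ≤ C)
    -- `X N` is the bike-sharing chain with `N` stations and `M N` bikes
    (X : (N : ℕ) → ℝ≥0 → Ω → BikeSharing.State K N)
    (hX : ∀ N, BikeSharing.IsCTMC P
      (BikeSharing.generator (BikeSharing.jumpRate (M N) (lam N))) (X N))
    (hM : ∀ N, ∀ᵐ ω ∂P, ∑ i, (X N 0 ω i : ℕ) ≤ M N)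
    (Λ γ : ℝ) (hΛ : 0 < Λ)
    -- weak convergence of the empirical law of the relative utilizations
    (I : Measure ℝ) [IsProbabilityMeasure I]
    (hI : ∀ f : ℝ →ᵇ ℝ, Tendsto
      (fun N => ∫ r, f r ∂(BikeSharing.empiricalLaw (BikeSharing.relUtilization (lam N))))
      atTop (𝓝 (∫ r, f r ∂I)))
    (hR : Tendsto (fun N : ℕ => (N : ℝ) * BikeSharing.maxUtilization (lam N)) atTop (𝓝 Λ⁻¹))
    (hγ : Tendsto (fun N => (M N : ℝ) / (N : ℝ)) atTop (𝓝 γ))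
    -- weak convergence in probability of the initial empirical measures
    (y₀ : Fin (K + 1) → Measure ℝ) [∀ k, IsFiniteMeasure (y₀ k)]
    (hy₀ : ∀ (k : Fin (K + 1)) (f : ℝ →ᵇ ℝ), TendstoInMeasure P
      (fun N ω => ∫ r, f r ∂(BikeSharing.empiricalMeasure
        (BikeSharing.relUtilization (lam N)) (X N 0 ω) k))
      atTop (fun _ => ∫ r, f r ∂(y₀ k))) :
    ∃ y : ℝ → Fin (K + 1) → Measure ℝ,
      BikeSharing.IsMeanFieldSolution Λ γ y₀ y ∧
      (∀ z : ℝ → Fin (K + 1) → Measure ℝ, BikeSharing.IsMeanFieldSolution Λ γ y₀ z →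
        ∀ t, 0 ≤ t → z t = y t) ∧
      ∀ ε : ℝ, 0 < ε → ∀ t₀ : ℝ≥0, 0 < t₀ →
        Tendsto (fun N => P {ω | ENNReal.ofReal ε <
            ⨆ (t : ℝ≥0) (_ : t ≤ t₀),
              ‖BikeSharing.proportions (X N t ω) - BikeSharing.masses (y t)‖ₑ})
          atTop (𝓝 0) := by
  obtain ⟨C, c, hc, C', s, hC, rfl, hC', hrange, hlams, hs⟩ := exists_rate_bound hlam hbdd hΛ hR
  obtain ⟨hy0c, hy0m, hy0γ⟩ := initial_measure_facts hM hγ hrange hy₀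
  set w : ℝ →ᵇ ℝ := inverseWeight c hc with hw
  have hw0 : ∀ r, 0 ≤ w r := inverseWeight_nonneg hc
  have hw1 : ∀ r, w r ≤ 1 := inverseWeight_le_one hc
  have hwa : ∀ (a : ℕ) r, (w ^ a) r ∈ Icc (0 : ℝ) 1 := fun a r =>
    ⟨pow_nonneg (hw0 r) a, pow_le_one₀ (hw0 r) (hw1 r)⟩
  obtain ⟨p, hp0, hp, hpn, hp1, hpγ⟩ := exists_transition_solution hC hw0 hw1 γ y₀ hy0γ
  have hsol : IsMeanFieldSolution (C * c) γ y₀ fun t => transport y₀ (p t) :=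
    isMeanFieldSolution_transport hc hy0c hp0 hp hpn
  refine ⟨fun t => transport y₀ (p t), hsol,
    fun z hz t ht => hz.eq hC hc hy0c hy0m hsol ht, fun ε hε t₀ ht₀ => ?_⟩
  have hbikes : ∀ t, ∑ l : Fin (K + 1), (l : ℝ) * pairing y₀ (w ^ 0) (p t) l =
      transitionBikes y₀ (p t) := fun t => by
    simp only [pow_zero, pairing, one_mul, transitionBikes]
  have hmasses : ∀ t, 0 ≤ t → masses (transport y₀ (p t)) =
      WithLp.toLp 2 (pairing y₀ (w ^ 0) (p t)) := fun t ht => by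
    unfold masses
    congr 1
    funext k
    rw [real_transport y₀ (hpn t ht) k MeasurableSet.univ]
    simp
  have hinit : ∀ (a : ℕ) (k : Fin (K + 1)), TendstoInMeasure P
      (fun N ω => moment (fun i => w (relUtilization (lam N) i)) a k (X N 0 ω)) atTop
      fun _ => pairing y₀ (w ^ a) (p 0) k := by
    intro a k
    -- The moment of order `a` is the integral of the bounded continuous function `w ^ a`, so its
    -- initial convergence is an instance of the hypothesis.
    have h := hy₀ k (w ^ a)
    simp only [integral_empiricalMeasure] at h
    rwa [← integral_transport y₀ (hpn 0 le_rfl), transport_initial y₀ hp0]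
  have hlim := tendsto_measure_lt_iSup hX (fun N i => (hlam N i).le) hC' hC hlams
    (fun N i => hw0 _) (fun N i => hw1 _) hs hγ
    (z := fun t a => pairing y₀ (w ^ a) (p t))
    (fun t ht a k => (pairing_mem_Icc hy0m (hwa a) (hpn t ht) (hp1 t ht) k).1)
    (fun t ht a k => (pairing_mem_Icc hy0m (hwa a) (hpn t ht) (hp1 t ht) k).2)
    (fun t ht => (hbikes t).trans_le (hpγ t ht))
    (fun t ht a k => by
      refine (hasDerivWithinAt_pairing y₀ (hp t ht) (w ^ a) k).congr_deriv ?_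
      simp only [momentDrift, hbikes, pow_succ])
    hinit hε ht₀
  refine hlim.congr fun N => ?_
  congr 1
  ext ω
  simp only [mem_ofPred_eq, lt_iSup_enorm_iff hε.le]
  simp only [hmasses _ (NNReal.coe_nonneg _)]
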